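/- Let $k$ be a field and $n\ge 0$. Let $E=\{1<\dots<n<1^*<\dots<n^*\}$, with the involution $i\leftrightarrow i^*$, and let $\omega(X,Y)=\sum_{i=1}^n\big(X(i)Y(i^*)-X(i^*)Y(i)\big)$ be the standard symplectic form on $k^E$. The Lagrangian Grassmannian $\mathrm{Lag}_k(n)$ is the set of maximal isotropic subspaces of $(k^E,\omega)$. A skew pair is a set $\{i,i^*\}$. A transversal is an $n$-element subset of $E$ containing no skew pair, an almost-transversal is an $n$-element subset of $E$ containing exactly one skew pair, and a subtransversal is a subset of a transversal. For a set $S$ with a linear order on the ambient set, $S_{<e}$ (resp. $S_{\le e}$) denotes the number of elements of $S$ smaller than (resp. smaller than or equal to) $e$. Let $V_n$ be the space of vectors $x=(x_B)$ over $k$, indexed by the transversals and almost-transversals $B$, that satisfy $(-1)^i x_{S\cup\{i,i^*\}}=(-1)^j x_{S\cup\{j,j^*\}}$ for every subtransversal $S$ of size $n-2$ and all distinct $i,j\in[n]$ whose skew pairs are disjoint from $S$. (1) $\dim_k V_n=2^{n-2}\big(4+\binom n2\big)$, so $\mathbb P(V_n)$ is a projective space of dimension $2^{n-2}\big(4+\binom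 n2\big)-1$. (2) Every $W\in\mathrm{Lag}_k(n)$ is the row space of an $n\times E$ matrix $\Lambda$, and for every such $\Lambda$ the vector $\big(\det\Lambda[n,B]\big)_B$ is a nonzero element of $V_n$ whose class $\Phi(W)\in\mathbb P(V_n)$ depends only on $W$. The map $\Phi:\mathrm{Lag}_k(n)\to\mathbb P(V_n)$ is injective, and its image is the set of points that satisfy all restricted Grassmann–Plücker relations $$\sum_{e\in S\setminus T}(-1)^{S_{<e}+T_{<e}}\,x_{S-e}\,x_{T+e}=0,\qquad(\ddagger)$$ where $S,T\subseteq E$ have sizes $n+1$ and $n-1$, $S$ contains exactly one skew pair, and $T$ contains none. (3) These relations correspond to Laplace expansions of principal and almost-principal minors of symmetric matrices, as follows. For $X,Y\subseteq[n]$ put $d_x[X,Y]=(-1)^{m}x_{([n]\setminus X)\cup Y^*}$ with $m=\sum_{i\in[n]\setminus X}\big(i+([n]\setminus X)_{\le i}\big)$. If $A$ is a symmetric $n\times n$ matrix over $k$, then the row space $W$ of $\Lambda=[I\,|\,A]$ is Lagrangian, and for $x_B=\det\Lambda[n,B]$ one has $d_x[X,Y]=\det A[X,Y]$ whenever $|X|=|Y|$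 and $|X\setminus Y|\le 1$. For $U\subseteq V\subseteq[n]$ and $i,j\in[n]\setminus V$, the sets $S=([n]\setminus V)\cup(V+j)^*$ and $T=([n]\setminus(U+i))\cup U^*$ are as in $(\ddagger)$, and, for arbitrary values of the coordinates $x_B$ and up to a sign depending only on $U,V,i,j$ (and $n$), the left-hand side of $(\ddagger)$ equals $$d_x[U,U]\,d_x[V+i,V+j]-\sum_{j'\in(V+j)\setminus U}(-1)^{(V\setminus U)_{<i}+((V+j)\setminus U)_{<j'}}\,d_x[U+i,U+j']\,d_x[V,V+j-j'].$$ -/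

import Mathlib

namespace LagGr

open Finset

/-- The ground set `E = {1 < ⋯ < n < 1* < ⋯ < n*}`, linearly ordered lexicographically. -/
abbrev E (n : ℕ) : Type := Fin n ⊕ₗ Fin n

/-- The unstarred copy of `i`. -/
def un {n : ℕ} (i : Fin n) : E n := toLex (Sum.inl i)

/-- The starred copy `i*` of `i`. -/
def st {n : ℕ} (i : Fin n) : E n := toLex (Sum.inr i)

/-- The involution `*` on `E`. -/
def star {n : ℕ} (e : E n) : E n := toLex (Sum.swap (ofLex e))

/-- The skew pair `{i, i*}`. -/
def skewPair {n : ℕ} (i : Fin n) : Finset (E n) := {un i, st i}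

/-- `n`-element sets with `T ∩ T* = ∅`. -/
def IsTransversal {n : ℕ} (T : Finset (E n)) : Prop :=
  T.card = n ∧ (T ∩ T.image star).card = 0

/-- `n`-element sets containing exactly one skew pair (then `A ∩ A*` is this pair). -/
def IsAlmostTransversal {n : ℕ} (A : Finset (E n)) : Prop :=
  A.card = n ∧ (A ∩ A.image star).card = 2

def IsSubtransversal {n : ℕ} (S : Finset (E n)) : Prop :=
  ∃ T : Finset (E n), IsTransversal T ∧ S ⊆ T

/-- The index set of the coordinates: transversals and almost-transversals. -/
abbrev Coord (n : ℕ) : Type :=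
  {B : Finset (E n) // IsTransversal B ∨ IsAlmostTransversal B}

theorem Coord.card_eq {n : ℕ} (B : Coord n) : B.1.card = n :=
  B.2.elim (fun h => h.1) (fun h => h.1)

/-- The number of elements of `S` smaller than `e`. -/
def smaller {α : Type*} [LinearOrder α] (S : Finset α) (e : α) : ℕ :=
  (S.filter (fun y => y < e)).card

/-- The number of elements of `S` smaller than or equal to `e`. -/
def smallerEq {α : Type*} [LinearOrder α] (S : Finset α) (e : α) : ℕ :=
  (S.filter (fun y => y ≤ e)).card

section Field

variable {k : Type*} [Field k] {n : ℕ}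

/-- The standard symplectic form on `k^E`. -/
def symp (X Y : E n → k) : k :=
  ∑ i : Fin n, (X (un i) * Y (st i) - X (st i) * Y (un i))

def IsIsotropic (W : Submodule k (E n → k)) : Prop :=
  ∀ X ∈ W, ∀ Y ∈ W, symp X Y = 0

/-- Lagrangian subspaces: the maximal isotropic ones. -/
def IsLagrangian (W : Submodule k (E n → k)) : Prop :=
  Maximal IsIsotropic W

variable (k n) in
/-- The Lagrangian Grassmannian. -/
abbrev Lag : Type _ := {W : Submodule k (E n → k) // IsLagrangian W}

open Classical in
/-- The coordinate `x_B`; only used for `B` a transversal or an almost-transversal. -/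
noncomputable def coord (x : Coord n → k) (B : Finset (E n)) : k :=
  if h : IsTransversal B ∨ IsAlmostTransversal B then x ⟨B, h⟩ else 0

theorem coord_zero (B : Finset (E n)) : coord (0 : Coord n → k) B = 0 := by
  unfold coord; split <;> simp

theorem coord_add (x y : Coord n → k) (B : Finset (E n)) :
    coord (x + y) B = coord x B + coord y B := by
  unfold coord; split <;> simp

theorem coord_smul (c : k) (x : Coord n → k) (B : Finset (E n)) :
    coord (c • x) B = c * coord x B := by
  unfold coord; split <;> simp

variable (k n) in
/-- The vectors indexed by transversals and almost-transversals, with the coordinates identified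
along `(-1)^i x_{S + {i,i*}} = (-1)^j x_{S + {j,j*}}` for each subtransversal `S` of size `n - 2`
and distinct `i, j` whose skew pairs do not meet `S`. -/
def CoordSpace : Submodule k (Coord n → k) where
  carrier := {x | ∀ (S : Finset (E n)) (i j : Fin n), IsSubtransversal S → S.card + 2 = n →
    i ≠ j → Disjoint (skewPair i) S → Disjoint (skewPair j) S →
    (-1) ^ (i : ℕ) * coord x (S ∪ skewPair i) = (-1) ^ (j : ℕ) * coord x (S ∪ skewPair j)}
  add_mem' := by
    intro x y hx hy S i j h1 h2 h3 h4 h5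
    rw [coord_add, coord_add, mul_add, mul_add, hx S i j h1 h2 h3 h4 h5, hy S i j h1 h2 h3 h4 h5]
  zero_mem' := by
    intro S i j _ _ _ _ _
    rw [coord_zero, coord_zero, mul_zero, mul_zero]
  smul_mem' := by
    intro c x hx S i j h1 h2 h3 h4 h5
    rw [coord_smul, coord_smul, mul_left_comm, hx S i j h1 h2 h3 h4 h5, mul_left_comm]

/-- The row space of an `n × E` matrix. -/
def rowSpace (L : Matrix (Fin n) (E n) k) : Submodule k (E n → k) :=
  Submodule.span k (Set.range L.row)

/-- The maximal minors `det L[n, B]`, for `B` a transversal or an almost-transversal; the columns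
are taken in increasing order. -/
def plucker (L : Matrix (Fin n) (E n) k) (B : Coord n) : k :=
  (L.submatrix id (B.1.orderEmbOfFin B.card_eq)).det

/-- The pairs `(S, T)` of subsets of `E` of sizes `n + 1` and `n - 1` such that `S` contains
exactly one skew pair and `T` contains none. -/
def IsRGPIndex (S T : Finset (E n)) : Prop :=
  S.card = n + 1 ∧ T.card + 1 = n ∧ (∃! i : Fin n, skewPair i ⊆ S) ∧
    ∀ j : Fin n, ¬ skewPair j ⊆ T

/-- The quadric of the restricted Grassmann–Plücker relation at `(S, T)`. For `(S, T)` as in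
`IsRGPIndex`, all the sets `S - e` and `T + e` are transversals or almost-transversals. -/
noncomputable def rgp (x : Coord n → k) (S T : Finset (E n)) : k :=
  ∑ e ∈ S \ T, (-1) ^ (smaller S e + smaller T e) * coord x (S.erase e) * coord x (insert e T)

/-- A point satisfies all restricted Grassmann–Plücker relations. These are homogeneous, so the
choice of the representing vector does not matter. -/
def SatisfiesRGP (p : Projectivization k (CoordSpace k n)) : Prop :=
  ∀ S T : Finset (E n), IsRGPIndex S T → rgp p.rep.1 S T = 0

/-- The matrix `[I | A]`. -/
def graphMatrix (A : Matrix (Fin n) (Fin n) k) : Matrix (Fin n) (E n) k :=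
  (Matrix.fromCols 1 A).submatrix id ofLex

/-- The minor `det A[X, Y]`, for `|X| = |Y|`. -/
def minor (A : Matrix (Fin n) (Fin n) k) (X Y : Finset (Fin n)) (h : Y.card = X.card) : k :=
  (A.submatrix (X.orderEmbOfFin rfl) (Y.orderEmbOfFin h)).det

/-- The set `[n] - X + Y*`. -/
def minorSet (X Y : Finset (Fin n)) : Finset (E n) :=
  Xᶜ.image un ∪ Y.image st

/-- `(-1)^m x_{[n] - X + Y*}` with `m = ∑_{i ∈ [n] - X} (i + |{y ∈ [n] - X : y ≤ i}|)`, where the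
elements of `[n]` are numbered from `1`. -/
noncomputable def minorCoord (x : Coord n → k) (X Y : Finset (Fin n)) : k :=
  (-1) ^ (∑ i ∈ Xᶜ, ((i : ℕ) + 1 + smallerEq Xᶜ i)) * coord x (minorSet X Y)

/-- The difference of the two sides of the Laplace expansion
`d[U,U] d[V+i,V+j] = ∑_{j' ∈ (V+j)∖U} ± d[U+i,U+j'] d[V,V+j-j']`, for quantities `d[X,Y]` in the
place of the minors of a matrix. -/
def laplaceDiff (d : Finset (Fin n) → Finset (Fin n) → k) (U V : Finset (Fin n))
    (i j : Fin n) : k :=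
  d U U * d (insert i V) (insert j V) -
    ∑ j' ∈ insert j V \ U, (-1) ^ (smaller (V \ U) i + smaller (insert j V \ U) j') *
      d (insert i U) (insert j' U) * d V ((insert j V).erase j')

end Field

end LagGr

/-! A subset of E is coded as `minorSet X Y`, that is, ([n] - X) + Y*. Transversals are the sets
with X = Y, and almost-transversals those with X = V+i, Y = V+j for distinct i, j outside V. The
linear relations link (V+i, V+j) with (V+j, V+i) and nothing else, so 2^n + C(n,2) 2^(n-2)
coordinates are free.

Plücker vectors satisfy the linear relations (`plucker_mem_CoordSpace`): det L[S+e+f] is, up to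
sign, an alternating form in the columns e and f, while isotropy of the row space says that the sum
over l of (column l) ⊗ (column l*) is symmetric. Their pairing vanishes, and if S misses exactly the
skew pairs of i and j, only two terms survive. The quadratic relations hold for every matrix
(`rgp_plucker`): e ↦ ±det L[T+e] lies in the row space, and e ↦ ±det L[S-e], extended by 0 outside
S, is orthogonal to all rows.

Conversely, let x ≠ 0 satisfy both kinds of relations. If x vanished at all transversals, suitable
quadratic relations would reduce to products of two linked coordinates, forcing x = 0. So x is
nonzero at some transversal B. The n vectors e ↦ ±x_{B-f+e}, for f in B, are pairwise orthogonal by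
the linear relations and independent because x_B ≠ 0; they span a Lagrangian subspace
(`isLagrangian_cocircuitMatrix`). Its Plücker vector is proportional to x at B and at the sets
B-f+e, and the quadratic relations propagate the agreement to all coordinates by induction on the
distance from B (`eq_of_coord_eq_near`).

Applied to the Plücker vector of W, the same vectors span W, whence injectivity. The required
nonzero transversal minor exists because a Lagrangian subspace projects isomorphically to the
coordinates of some transversal.

The Laplace form of a relation is a termwise comparison of signs. Its case U = ∅ identifies the
coordinates of [I | A] with minors of A by induction on their size. -/

namespace LagGr

open Finset

/-! ### Maximal minors: signs, expansions and Grassmann–Plücker relations -/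

section Minors

variable {α : Type*} [LinearOrder α] {k : Type*} [Field k] {m : ℕ}

theorem smaller_orderEmbOfFin (S : Finset α) (h : S.card = m) (t : Fin m) :
    smaller S (S.orderEmbOfFin h t) = t := by
  have : S.filter (fun y => y < S.orderEmbOfFin h t)
      = (Finset.Iio t).map (S.orderEmbOfFin h).toEmbedding := by
    ext y
    simp only [mem_filter, mem_map, mem_Iio]
    constructor
    · rintro ⟨hy, hlt⟩
      have : y ∈ Set.range (S.orderEmbOfFin h) := by rw [range_orderEmbOfFin]; exact hy
      obtain ⟨u, rfl⟩ := this
      exact ⟨u, by simpa using hlt, rfl⟩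
    · rintro ⟨u, hu, rfl⟩
      exact ⟨orderEmbOfFin_mem _ _ _, by simpa using hu⟩
  rw [smaller, this, card_map, Fin.card_Iio]

theorem smaller_lt (S : Finset α) {e : α} (he : e ∈ S) (h : S.card = m) : smaller S e < m := by
  have : e ∈ Set.range (S.orderEmbOfFin h) := by rw [range_orderEmbOfFin]; exact he
  obtain ⟨t, rfl⟩ := this
  rw [smaller_orderEmbOfFin]
  exact t.2

theorem orderEmbOfFin_smaller (S : Finset α) {e : α} (he : e ∈ S) (h : S.card = m) :
    S.orderEmbOfFin h ⟨smaller S e, smaller_lt S he h⟩ = e := by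
  have : e ∈ Set.range (S.orderEmbOfFin h) := by rw [range_orderEmbOfFin]; exact he
  obtain ⟨t, rfl⟩ := this
  congr 1
  exact Fin.ext (smaller_orderEmbOfFin S h t)

theorem sum_orderEmbOfFin {M : Type*} [AddCommMonoid M] (S : Finset α) (h : S.card = m)
    (f : α → M) : ∑ t : Fin m, f (S.orderEmbOfFin h t) = ∑ e ∈ S, f e := by
  conv_rhs => rw [← map_orderEmbOfFin_univ S h]
  rw [sum_map]
  rfl

/-- The minor on the columns in `B`, taken in increasing order, if there are as many columns as
rows, and `0` otherwise. -/
def maxMinor (L : Matrix (Fin m) α k) (B : Finset α) : k :=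
  if h : B.card = m then (L.submatrix id (B.orderEmbOfFin h)).det else 0

theorem maxMinor_of_card (L : Matrix (Fin m) α k) (B : Finset α) (h : B.card = m) :
    maxMinor L B = (L.submatrix id (B.orderEmbOfFin h)).det := dif_pos h

/-- With the new column in front, the determinant is linear in it, with coefficients that do not
depend on the column; this is what puts vectors of minors into the row space. -/
theorem det_cons_eq_sum {γ : Type*} (L : Matrix (Fin (m + 1)) γ k) (e : γ) (c : Fin m → γ) :
    (L.submatrix id (Fin.cons e c : Fin (m + 1) → γ)).det =
      ∑ a : Fin (m + 1), (-1) ^ (a : ℕ) * L a e * (L.submatrix a.succAbove c).det := by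
  rw [Matrix.det_succ_column_zero]
  rfl

theorem det_cons_of_mem_range {γ : Type*} (L : Matrix (Fin (m + 1)) γ k) (e : γ) (c : Fin m → γ)
    (he : e ∈ Set.range c) :
    (L.submatrix id (Fin.cons e c : Fin (m + 1) → γ)).det = 0 := by
  obtain ⟨t, rfl⟩ := he
  exact Matrix.det_zero_of_column_eq (Fin.succ_ne_zero t).symm fun a => by simp

/-- A symmetric array paired with an alternating one gives `0`. -/
theorem sum_alternating_mul_symmetric {ι : Type*} [Fintype ι] [DecidableEq ι]
    (M N : ι → ι → k) (h0 : ∀ a, M a a = 0)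
    (hM : ∀ a b, M a b = -M b a) (hN : ∀ a b, N a b = N b a) :
    ∑ a, ∑ b, M a b * N a b = 0 := by
  rw [← sum_product']
  refine sum_involution (fun p _ => (p.2, p.1)) ?_ ?_ ?_ ?_
  · rintro ⟨a, b⟩ -
    simp only
    rw [hM a b, hN a b]
    ring
  · rintro ⟨a, b⟩ - hne heq
    obtain rfl : b = a := congrArg Prod.fst heq
    exact hne (by simp [h0])
  · simp
  · simp

variable [DecidableEq α]

theorem orderEmbOfFin_comp_succAbove (S : Finset α) (h : S.card = m + 1) (t : Fin (m + 1))
    {T : Finset α} (hT : T.card = m) (hST : T = S.erase (S.orderEmbOfFin h t)) :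
    S.orderEmbOfFin h ∘ t.succAbove = T.orderEmbOfFin hT := by
  apply orderEmbOfFin_unique
  · intro u
    rw [hST, mem_erase]
    refine ⟨fun hu => ?_, orderEmbOfFin_mem _ _ _⟩
    exact Fin.succAbove_ne t u ((S.orderEmbOfFin h).injective hu)
  · exact (S.orderEmbOfFin h).strictMono.comp (Fin.strictMono_succAbove t)

theorem smaller_insert (T : Finset α) {e f : α} (hf : f ∉ T) :
    smaller (insert f T) e = smaller T e + if f < e then 1 else 0 := by
  unfold smaller
  rw [filter_insert]
  split_ifs with h
  · rw [card_insert_of_notMem (by simp [hf])]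
  · simp

theorem smaller_insert_self (T : Finset α) (e : α) : smaller (insert e T) e = smaller T e := by
  unfold smaller
  rw [filter_insert, if_neg (lt_irrefl e)]

theorem smaller_erase_self (T : Finset α) (e : α) : smaller (T.erase e) e = smaller T e := by
  rw [← smaller_insert_self (T.erase e)]
  by_cases h : e ∈ T
  · rw [insert_erase h]
  · rw [erase_eq_of_notMem h, smaller_insert_self]

theorem smaller_sdiff (S T : Finset α) (h : T ⊆ S) (e : α) :
    smaller (S \ T) e + smaller T e = smaller S e := by
  unfold smaller
  rw [← card_union_of_disjoint]
  · rw [← filter_union, sdiff_union_of_subset h]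
  · exact disjoint_filter_filter sdiff_disjoint

/-- Moving the column e from the front to its sorted place passes exactly the smaller elements of T.
In the proof both determinants are expanded along the column e, and the cofactors agree. -/
theorem det_cons_orderEmbOfFin (L : Matrix (Fin (m + 1)) α k) (T : Finset α) (h : T.card = m)
    {e : α} (he : e ∉ T) :
    (L.submatrix id (Fin.cons e (T.orderEmbOfFin h) : Fin (m + 1) → α)).det =
      (-1) ^ smaller T e * maxMinor L (insert e T) := by
  have hc : (insert e T).card = m + 1 := by rw [card_insert_of_notMem he, h]
  rw [maxMinor_of_card L _ hc]
  set p : Fin (m + 1) := ⟨smaller (insert e T) e, smaller_lt _ (mem_insert_self e T) hc⟩ with hp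
  have hpe : (insert e T).orderEmbOfFin hc p = e :=
    orderEmbOfFin_smaller _ (mem_insert_self e T) hc
  have hpv : smaller T e = p := (smaller_insert_self T e).symm
  rw [det_cons_eq_sum, Matrix.det_succ_column _ p, mul_sum]
  refine sum_congr rfl fun a _ => ?_
  have h2 : (insert e T).orderEmbOfFin hc ∘ p.succAbove = T.orderEmbOfFin h :=
    orderEmbOfFin_comp_succAbove _ _ _ _ (by rw [hpe, erase_insert he])
  rw [Matrix.submatrix_submatrix, h2, Matrix.submatrix_apply, hpe, hpv, Function.id_comp, id,
    pow_add]
  have : (-1 : k) ^ (p : ℕ) * (-1) ^ (p : ℕ) = 1 := by rw [← mul_pow]; simp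
  linear_combination (-(-1 : k) ^ (a : ℕ) * L a e *
    (L.submatrix a.succAbove (T.orderEmbOfFin h)).det) * this

/-- Expansion along e reduces to cofactors with f in front; sorting f gives one sign common to all
cofactors, and sorting e into S + f gives the other. -/
theorem det_cons_cons_orderEmbOfFin (L : Matrix (Fin (m + 2)) α k) (S : Finset α)
    (h : S.card = m) {e f : α} (he : e ∉ S) (hf : f ∉ S) (hef : e ≠ f) :
    (L.submatrix id (Fin.cons e (Fin.cons f (S.orderEmbOfFin h) : Fin (m + 1) → α) :
      Fin (m + 2) → α)).det =
      (-1) ^ (smaller S f + smaller (insert f S) e) * maxMinor L (insert e (insert f S)) := by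
  have hc : (insert f S).card = m + 1 := by rw [card_insert_of_notMem hf, h]
  rw [pow_add, mul_assoc, ← det_cons_orderEmbOfFin L (insert f S) hc (by simp [he, hef]),
    det_cons_eq_sum, det_cons_eq_sum, mul_sum]
  refine sum_congr rfl fun a _ => ?_
  have := det_cons_orderEmbOfFin (L.submatrix a.succAbove id) S h hf
  rw [maxMinor_of_card _ _ hc] at this
  simp only [Matrix.submatrix_submatrix, Function.comp_id, Function.id_comp] at this
  rw [this]
  ring

/-- The vector `e ↦ (-1)^{|T_{<e}|} det L[T + e]` is a combination of the rows of `L`. -/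
theorem exists_comb_eq_minor (L : Matrix (Fin m) α k) (T : Finset α) (h : T.card + 1 = m) :
    ∃ c : Fin m → k, ∀ e, ∑ a, c a * L a e =
      if e ∈ T then 0 else (-1) ^ smaller T e * maxMinor L (insert e T) := by
  subst h
  refine ⟨fun a => (-1) ^ (a : ℕ) * (L.submatrix a.succAbove (T.orderEmbOfFin rfl)).det,
    fun e => ?_⟩
  have := det_cons_eq_sum L e (T.orderEmbOfFin rfl)
  split_ifs with he
  · rw [det_cons_of_mem_range _ _ _ (by rw [range_orderEmbOfFin]; exact he)] at this
    rw [this]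
    exact sum_congr rfl fun a _ => by ring
  · rw [← det_cons_orderEmbOfFin L T rfl he, this]
    exact sum_congr rfl fun a _ => by ring

/-- The Grassmann–Plücker relation, linear form. -/
theorem sum_minor_mul_eq_zero (L : Matrix (Fin m) α k) (S : Finset α) (h : S.card = m + 1)
    (a : Fin m) :
    ∑ e ∈ S, (-1) ^ smaller S e * maxMinor L (S.erase e) * L a e = 0 := by
  -- Row a is repeated on top of L, so the determinant on the columns S is 0; its expansion along
  -- the top row is the claim.
  let L' : Matrix (Fin (m + 1)) α k := Fin.cons (L a) L
  have h0 : (L'.submatrix id (S.orderEmbOfFin h)).det = 0 := by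
    refine Matrix.det_zero_of_row_eq (Fin.succ_ne_zero a).symm ?_
    ext t
    rfl
  rw [← sum_orderEmbOfFin S h, ← h0, Matrix.det_succ_row_zero]
  refine sum_congr rfl fun t _ => ?_
  have hc : (S.erase (S.orderEmbOfFin h t)).card = m := by
    rw [card_erase_of_mem (orderEmbOfFin_mem _ _ _), h]; rfl
  rw [smaller_orderEmbOfFin, maxMinor_of_card _ _ hc,
    ← orderEmbOfFin_comp_succAbove S h t hc rfl, Matrix.submatrix_submatrix]
  have : L'.submatrix (id ∘ Fin.succ) (S.orderEmbOfFin h ∘ t.succAbove) =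
      L.submatrix id (S.orderEmbOfFin h ∘ t.succAbove) := by
    ext; rfl
  rw [this]
  have : L'.submatrix id (S.orderEmbOfFin h) 0 t = L a (S.orderEmbOfFin h t) := rfl
  rw [this]
  ring

/-- The Laplace expansion of a square submatrix along a row. -/
theorem det_submatrix_insert {β : Type*} [LinearOrder β] [DecidableEq β] (A : Matrix β α k)
    (X : Finset β) (Y : Finset α) {i : β} (hi : i ∉ X) (hX : X.card = m) (hX' : (insert i X).card = m + 1)
    (hY : Y.card = m + 1) :
    (A.submatrix ((insert i X).orderEmbOfFin hX') (Y.orderEmbOfFin hY)).det =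
      ∑ j ∈ Y, (-1) ^ (smaller X i + smaller Y j) * A i j *
        maxMinor (A.submatrix (X.orderEmbOfFin hX) id) (Y.erase j) := by
  rw [← sum_orderEmbOfFin Y hY]
  set p : Fin (m + 1) := ⟨smaller (insert i X) i, smaller_lt _ (mem_insert_self i X) hX'⟩ with hp
  have hpe : (insert i X).orderEmbOfFin hX' p = i :=
    orderEmbOfFin_smaller _ (mem_insert_self i X) hX'
  have hpv : smaller X i = p := (smaller_insert_self X i).symm
  rw [Matrix.det_succ_row _ p]
  refine sum_congr rfl fun t _ => ?_
  have h2 : (insert i X).orderEmbOfFin hX' ∘ p.succAbove = X.orderEmbOfFin hX :=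
    orderEmbOfFin_comp_succAbove _ _ _ _ (by rw [hpe, erase_insert hi])
  have hc : (Y.erase (Y.orderEmbOfFin hY t)).card = m := by
    rw [card_erase_of_mem (orderEmbOfFin_mem _ _ _), hY]; rfl
  rw [smaller_orderEmbOfFin, maxMinor_of_card _ _ hc,
    ← orderEmbOfFin_comp_succAbove Y hY t hc rfl, Matrix.submatrix_submatrix,
    Matrix.submatrix_submatrix, h2, Matrix.submatrix_apply, hpe, hpv]
  rfl

/-- The double expansion: the minors `det L[S + e + f]` are, up to sign, the values of an
alternating form at the columns `e` and `f`. -/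
theorem exists_alternating_eq_minor (L : Matrix (Fin m) α k) (S : Finset α) (h : S.card + 2 = m) :
    ∃ M : Fin m → Fin m → k, (∀ a, M a a = 0) ∧ (∀ a b, M a b = -M b a) ∧
      (∀ e f, (e ∈ S ∨ f ∈ S) → ∑ a, ∑ b, M a b * (L a e * L b f) = 0) ∧
      ∀ e f, e ∉ S → f ∉ S → e ≠ f → ∑ a, ∑ b, M a b * (L a e * L b f) =
        (-1) ^ (smaller S f + smaller (insert f S) e) * maxMinor L (insert e (insert f S)) := by
  subst h
  set c : Fin S.card → Fin (S.card + 2) → k := fun t a => L a (S.orderEmbOfFin rfl t) with hc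
  let F := Matrix.detRowAlternating (R := k) (n := Fin (S.card + 2))
  -- β(u, v) is the determinant with vectors u, v followed by the columns in S, all written as rows.
  -- The array M consists of the values of β on basis vectors.
  let β : (Fin (S.card + 2) → k) →ₗ[k] (Fin (S.card + 2) → k) →ₗ[k] k :=
    LinearMap.mk₂ k (fun u v => (F.curryLeft u).curryLeft v c)
      (fun u u' v => by rw [map_add, AlternatingMap.curryLeft_add]; rfl)
      (fun r u v => by rw [map_smul, AlternatingMap.curryLeft_smul]; rfl)
      (fun u v v' => by rw [map_add]; rfl) (fun r u v => by rw [map_smul]; rfl)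
  have hβ (u v) : β u v = ∑ a, ∑ b, β (Pi.single a 1) (Pi.single b 1) * (u a * v b) := by
    conv_lhs => rw [pi_eq_sum_univ' u, pi_eq_sum_univ' v]
    simp only [map_sum, map_smul, LinearMap.sum_apply, LinearMap.smul_apply, smul_eq_mul]
    simp only [mul_sum]
    rw [sum_comm]
    exact sum_congr rfl fun a _ => sum_congr rfl fun b _ => by ring
  have hββ (u) : β u u = 0 := by
    change (F.curryLeft u).curryLeft u c = 0
    rw [AlternatingMap.curryLeft_same]
    rfl
  have hL (e f) : β (fun a => L a e) (fun a => L a f) = (L.submatrix id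
      (Fin.cons e (Fin.cons f (S.orderEmbOfFin rfl) : Fin (S.card + 1) → α) :
      Fin (S.card + 2) → α)).det := by
    rw [← Matrix.det_transpose]
    change Matrix.det _ = _
    congr 1
    ext t a
    refine Fin.cases rfl (fun t => ?_) t
    refine Fin.cases rfl (fun t => ?_) t
    rfl
  refine ⟨fun a b => β (Pi.single a 1) (Pi.single b 1), fun a => hββ _, fun a b => ?_, ?_, ?_⟩
  -- Polarization of β(u, u) = 0.
  · have := hββ (Pi.single a 1 + Pi.single b 1)
    simp only [map_add, LinearMap.add_apply, hββ, zero_add, add_zero] at this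
    linear_combination this
  · intro e f hef
    rw [← hβ (fun a => L a e) (fun a => L a f), hL]
    rcases hef with he | hf
    · apply det_cons_of_mem_range
      have : e ∈ Set.range (S.orderEmbOfFin rfl) := by rw [range_orderEmbOfFin]; exact he
      obtain ⟨t, rfl⟩ := this
      exact ⟨t.succ, rfl⟩
    · have : f ∈ Set.range (S.orderEmbOfFin rfl) := by rw [range_orderEmbOfFin]; exact hf
      obtain ⟨t, rfl⟩ := this
      exact Matrix.det_zero_of_column_eq (i := 1) (j := t.succ.succ)
        (by simp [Fin.ext_iff]) fun a => rfl
  · intro e f he hf hef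
    rw [← hβ (fun a => L a e) (fun a => L a f), hL, det_cons_cons_orderEmbOfFin L S rfl he hf hef]

end Minors

/-! ### Subsets of E as pairs of subsets of [n] -/

section MinorSet

variable {n : ℕ}

theorem E_cases (e : E n) : (∃ a, e = un a) ∨ ∃ a, e = st a := by
  rcases h : ofLex e with a | a
  · exact Or.inl ⟨a, by rw [un, ← h]; rfl⟩
  · exact Or.inr ⟨a, by rw [st, ← h]; rfl⟩

@[simp] theorem un_inj {a b : Fin n} : un a = un b ↔ a = b := by
  simp [un]

@[simp] theorem st_inj {a b : Fin n} : st a = st b ↔ a = b := by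
  simp [st]

@[simp] theorem un_ne_st {a b : Fin n} : un a ≠ st b := by
  simp [un, st]

@[simp] theorem st_ne_un {a b : Fin n} : st a ≠ un b := by
  simp [un, st]

@[simp] theorem un_lt_un {a b : Fin n} : un a < un b ↔ a < b := by
  simp [un]

@[simp] theorem st_lt_st {a b : Fin n} : st a < st b ↔ a < b := by
  simp [st]

@[simp] theorem un_lt_st {a b : Fin n} : un a < st b := by
  simp [un, st]

@[simp] theorem not_st_lt_un {a b : Fin n} : ¬ st a < un b := by
  simp [un, st]

@[simp] theorem star_un (a : Fin n) : star (un a) = st a := rfl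

@[simp] theorem star_st (a : Fin n) : star (st a) = un a := rfl

@[simp] theorem star_star (e : E n) : star (star e) = e := by
  rcases E_cases e with ⟨a, rfl⟩ | ⟨a, rfl⟩ <;> simp

@[simp] theorem un_mem_minorSet {X Y : Finset (Fin n)} {a : Fin n} :
    un a ∈ minorSet X Y ↔ a ∉ X := by
  simp [minorSet]

@[simp] theorem st_mem_minorSet {X Y : Finset (Fin n)} {a : Fin n} :
    st a ∈ minorSet X Y ↔ a ∈ Y := by
  simp [minorSet]

theorem ext_E {B C : Finset (E n)} (hu : ∀ a, un a ∈ B ↔ un a ∈ C)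
    (hs : ∀ a, st a ∈ B ↔ st a ∈ C) : B = C := by
  ext e
  rcases E_cases e with ⟨a, rfl⟩ | ⟨a, rfl⟩
  · exact hu a
  · exact hs a

theorem exists_eq_minorSet (B : Finset (E n)) : ∃ X Y, B = minorSet X Y :=
  ⟨univ.filter (fun a => un a ∉ B), univ.filter (fun a => st a ∈ B),
    ext_E (by simp) (by simp)⟩

theorem card_minorSet (X Y : Finset (Fin n)) : (minorSet X Y).card + X.card = n + Y.card := by
  have hd : Disjoint (Xᶜ.image un) (Y.image (st (n := n))) := by
    rw [disjoint_left]
    intro e he he'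
    obtain ⟨a, -, rfl⟩ := mem_image.1 he
    obtain ⟨b, -, h⟩ := mem_image.1 he'
    exact st_ne_un h
  rw [minorSet, card_union_of_disjoint hd, card_image_of_injective _ fun a b h => un_inj.1 h,
    card_image_of_injective _ fun a b h => st_inj.1 h]
  have := card_compl_add_card X
  rw [Fintype.card_fin] at this
  omega

/-- Each l in Y \ X contributes both elements of its skew pair; every other skew pair meets the set
in at most one element. -/
theorem card_inter_star (X Y : Finset (Fin n)) :
    (minorSet X Y ∩ (minorSet X Y).image star).card = 2 * (Y \ X).card := by
  have : minorSet X Y ∩ (minorSet X Y).image star =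
      (Y \ X).image un ∪ (Y \ X).image st := by
    have hst (e : E n) (B : Finset (E n)) : e ∈ B.image star ↔ star e ∈ B := by
      rw [mem_image]
      exact ⟨by rintro ⟨f, hf, rfl⟩; simpa using hf, fun h => ⟨star e, h, star_star e⟩⟩
    apply ext_E
    · intro a
      simp [hst, and_comm]
    · intro a
      simp [hst]
  rw [this, card_union_of_disjoint, card_image_of_injective _ fun a b h => un_inj.1 h,
    card_image_of_injective _ fun a b h => st_inj.1 h, two_mul]
  rw [disjoint_left]
  intro e he he'
  obtain ⟨a, -, rfl⟩ := mem_image.1 he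
  obtain ⟨b, -, h⟩ := mem_image.1 he'
  exact st_ne_un h

theorem isTransversal_minorSet {X Y : Finset (Fin n)} :
    IsTransversal (minorSet X Y) ↔ X = Y := by
  have h1 := card_minorSet X Y
  rw [IsTransversal, card_inter_star]
  constructor
  · rintro ⟨h, h'⟩
    have hs : Y ⊆ X := by
      rw [← sdiff_eq_empty_iff_subset, ← card_eq_zero]; omega
    exact (eq_of_subset_of_card_le hs (by omega)).symm
  · rintro rfl
    exact ⟨by omega, by simp⟩

/-- The size forces |X| = |Y|, and the single skew pair forces |Y \ X| = 1, hence |X \ Y| = 1; V is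
the intersection. -/
theorem isAlmostTransversal_minorSet {X Y : Finset (Fin n)} :
    IsAlmostTransversal (minorSet X Y) ↔ ∃ V i j, i ≠ j ∧ i ∉ V ∧ j ∉ V ∧
      X = insert i V ∧ Y = insert j V := by
  have h1 := card_minorSet X Y
  rw [IsAlmostTransversal, card_inter_star]
  constructor
  · rintro ⟨h, h'⟩
    have h2 : (Y \ X).card = 1 := by omega
    have h3 : (X \ Y).card = 1 := by
      rw [← h2]
      exact card_sdiff_comm (by omega)
    obtain ⟨j, hj⟩ := card_eq_one.1 h2
    obtain ⟨i, hi⟩ := card_eq_one.1 h3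
    have hj' (a) : (a ∈ Y ∧ a ∉ X) ↔ a = j := by rw [← mem_sdiff, hj, mem_singleton]
    have hi' (a) : (a ∈ X ∧ a ∉ Y) ↔ a = i := by rw [← mem_sdiff, hi, mem_singleton]
    have hj1 := (hj' j).2 rfl
    have hi1 := (hi' i).2 rfl
    refine ⟨X ∩ Y, i, j, ?_, ?_, ?_, ?_, ?_⟩
    · rintro rfl; exact hj1.2 hi1.1
    · simp [hi1]
    · simp [hj1]
    · ext a
      have := hi' a
      simp only [mem_insert, mem_inter]
      tauto
    · ext a
      have := hj' a
      simp only [mem_insert, mem_inter]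
      tauto
  · rintro ⟨V, i, j, hij, hi, hj, rfl, rfl⟩
    have : insert j V \ insert i V = {j} := by
      ext a
      simp only [mem_sdiff, mem_insert, mem_singleton]
      constructor
      · tauto
      · rintro rfl; tauto
    rw [this, card_singleton]
    rw [card_insert_of_notMem hi, card_insert_of_notMem hj] at h1
    exact ⟨by omega, rfl⟩

theorem isCoord_minorSet_insert {V : Finset (Fin n)} {i j : Fin n} (hi : i ∉ V) (hj : j ∉ V) :
    IsTransversal (minorSet (insert i V) (insert j V)) ∨
      IsAlmostTransversal (minorSet (insert i V) (insert j V)) := by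
  by_cases h : i = j
  · subst h; exact Or.inl (isTransversal_minorSet.2 rfl)
  · exact Or.inr (isAlmostTransversal_minorSet.2 ⟨V, i, j, h, hi, hj, rfl, rfl⟩)

theorem smaller_minorSet_un (X Y : Finset (Fin n)) (i : Fin n) :
    smaller (minorSet X Y) (un i) = smaller Xᶜ i := by
  have : (minorSet X Y).filter (fun y => y < un i) = (Xᶜ.filter (fun y => y < i)).image un :=
    ext_E (by simp) (by simp)
  rw [smaller, this, card_image_of_injective _ fun a b h => un_inj.1 h, smaller]

theorem smaller_minorSet_st (X Y : Finset (Fin n)) (i : Fin n) :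
    smaller (minorSet X Y) (st i) = Xᶜ.card + smaller Y i := by
  have : (minorSet X Y).filter (fun y => y < st i) =
      Xᶜ.image un ∪ (Y.filter (fun y => y < i)).image st :=
    ext_E (by simp) (by simp)
  rw [smaller, this, card_union_of_disjoint, card_image_of_injective _ fun a b h => un_inj.1 h,
    card_image_of_injective _ fun a b h => st_inj.1 h, smaller]
  rw [disjoint_left]
  intro e he he'
  obtain ⟨a, -, rfl⟩ := mem_image.1 he
  obtain ⟨b, -, h⟩ := mem_image.1 he'
  exact st_ne_un h

theorem insert_un_minorSet (X Y : Finset (Fin n)) (i : Fin n) :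
    insert (un i) (minorSet X Y) = minorSet (X.erase i) Y := by
  apply ext_E
  · intro a
    simp only [mem_insert, un_inj, un_mem_minorSet, mem_erase]
    tauto
  · simp

theorem insert_st_minorSet (X Y : Finset (Fin n)) (i : Fin n) :
    insert (st i) (minorSet X Y) = minorSet X (insert i Y) := by
  apply ext_E
  · simp
  · simp

theorem erase_un_minorSet (X Y : Finset (Fin n)) (i : Fin n) :
    (minorSet X Y).erase (un i) = minorSet (insert i X) Y := by
  apply ext_E
  · simp
  · simp

theorem erase_st_minorSet (X Y : Finset (Fin n)) (i : Fin n) :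
    (minorSet X Y).erase (st i) = minorSet X (Y.erase i) := by
  apply ext_E
  · simp
  · simp

theorem skewPair_subset_minorSet {X Y : Finset (Fin n)} {i : Fin n} :
    skewPair i ⊆ minorSet X Y ↔ i ∉ X ∧ i ∈ Y := by
  simp [skewPair, insert_subset_iff]

theorem disjoint_skewPair_minorSet {X Y : Finset (Fin n)} {i : Fin n} :
    Disjoint (skewPair i) (minorSet X Y) ↔ i ∈ X ∧ i ∉ Y := by
  simp [skewPair]

theorem minorSet_union_skewPair (X Y : Finset (Fin n)) (i : Fin n) :
    minorSet X Y ∪ skewPair i = minorSet (X.erase i) (insert i Y) := by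
  rw [skewPair, union_comm, insert_union, singleton_union, insert_st_minorSet, insert_un_minorSet]

theorem isSubtransversal_minorSet {X Y : Finset (Fin n)} :
    IsSubtransversal (minorSet X Y) ↔ Y ⊆ X := by
  constructor
  · rintro ⟨T, hT, h⟩
    obtain ⟨Z, Z', rfl⟩ := exists_eq_minorSet T
    obtain rfl := isTransversal_minorSet.1 hT
    intro a ha
    have := h (st_mem_minorSet.2 ha)
    by_contra hX
    have h2 := h (un_mem_minorSet.2 hX)
    simp at this h2
    exact h2 this
  · intro h
    refine ⟨minorSet Y Y, isTransversal_minorSet.2 rfl, fun e he => ?_⟩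
    rcases E_cases e with ⟨a, rfl⟩ | ⟨a, rfl⟩
    · simp only [un_mem_minorSet] at he ⊢
      exact fun ha => he (h ha)
    · simpa using he

/-- Subtransversals of size `n - 2` that miss the skew pairs of `i` and `j`. -/
theorem exists_eq_minorSet_insert_insert {S : Finset (E n)} {i j : Fin n}
    (hS : IsSubtransversal S) (hc : S.card + 2 = n) (hij : i ≠ j)
    (hi : Disjoint (skewPair i) S) (hj : Disjoint (skewPair j) S) :
    ∃ V, i ∉ V ∧ j ∉ V ∧ S = minorSet (insert i (insert j V)) V := by
  obtain ⟨X, V, rfl⟩ := exists_eq_minorSet S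
  rw [isSubtransversal_minorSet] at hS
  rw [disjoint_skewPair_minorSet] at hi hj
  refine ⟨V, hi.2, hj.2, ?_⟩
  have h1 := card_minorSet X V
  congr 1
  symm
  apply eq_of_subset_of_card_le
  · simp [insert_subset_iff, hi.1, hj.1, hS]
  · rw [card_insert_of_notMem (by simp [hij, hi.2]), card_insert_of_notMem hj.2]
    omega

/-- Having no skew pair means U ⊆ X' for T = `minorSet X' U`, and the size leaves one extra element
i in X'. Having only the skew pair of j means Y ⊆ V + j for S = `minorSet V Y`, and the size gives
equality. -/
theorem isRGPIndex_iff {S T : Finset (E n)} :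
    IsRGPIndex S T ↔ ∃ V j U i, j ∉ V ∧ i ∉ U ∧ S = minorSet V (insert j V) ∧
      T = minorSet (insert i U) U := by
  constructor
  · rintro ⟨h1, h2, ⟨j, h3, h4⟩, h5⟩
    obtain ⟨X, Y, rfl⟩ := exists_eq_minorSet S
    obtain ⟨X', U, rfl⟩ := exists_eq_minorSet T
    simp only [skewPair_subset_minorSet] at h3 h4 h5
    have c1 := card_minorSet X Y
    have c2 := card_minorSet X' U
    have hU : U ⊆ X' := fun a ha => by
      by_contra h
      exact h5 a ⟨h, ha⟩
    have : (X' \ U).card = 1 := by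
      have := card_sdiff_add_card_eq_card hU
      omega
    obtain ⟨i, hi⟩ := card_eq_one.1 this
    have hi' (a) : (a ∈ X' ∧ a ∉ U) ↔ a = i := by rw [← mem_sdiff, hi, mem_singleton]
    have hi1 := (hi' i).2 rfl
    refine ⟨X, j, U, i, h3.1, hi1.2, ?_, ?_⟩
    · congr 1
      apply eq_of_subset_of_card_le
      · intro a ha
        rw [mem_insert]
        by_cases haX : a ∈ X
        · exact Or.inr haX
        · exact Or.inl (h4 a ⟨haX, ha⟩)
      · rw [card_insert_of_notMem h3.1]; omega
    · congr 1
      ext a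
      have := hi' a
      have := @hU a
      rw [mem_insert]
      tauto
  · rintro ⟨V, j, U, i, hj, hi, rfl, rfl⟩
    have c1 := card_minorSet V (insert j V)
    have c2 := card_minorSet (insert i U) U
    rw [card_insert_of_notMem hj] at c1
    rw [card_insert_of_notMem hi] at c2
    refine ⟨by omega, by omega, ⟨j, ?_, ?_⟩, ?_⟩
    · simp [skewPair_subset_minorSet, hj]
    · intro a ha
      simp [skewPair_subset_minorSet] at ha
      tauto
    · intro a ha
      simp [skewPair_subset_minorSet] at ha
      tauto

/-- Adding an element to a set of size `n - 1` without skew pairs. -/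
theorem isCoord_insert {U : Finset (Fin n)} {i : Fin n} (hi : i ∉ U) {e : E n}
    (he : e ∉ minorSet (insert i U) U) :
    IsTransversal (insert e (minorSet (insert i U) U)) ∨
      IsAlmostTransversal (insert e (minorSet (insert i U) U)) := by
  rcases E_cases e with ⟨a, rfl⟩ | ⟨a, rfl⟩
  · rw [insert_un_minorSet]
    rw [un_mem_minorSet, not_not, mem_insert] at he
    rcases he with rfl | he
    · rw [erase_insert hi]
      exact Or.inl (isTransversal_minorSet.2 rfl)
    · have hia : i ≠ a := fun h => hi (h ▸ he)
      rw [erase_insert_of_ne hia]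
      have := isCoord_minorSet_insert (V := U.erase a) (i := i) (j := a) (by simp [hi]) (by simp)
      rwa [insert_erase he] at this
  · rw [insert_st_minorSet]
    rw [st_mem_minorSet] at he
    exact isCoord_minorSet_insert hi he

/-- Removing an element from a set of size `n + 1` with exactly one skew pair. -/
theorem isCoord_erase {V : Finset (Fin n)} {j : Fin n} (hj : j ∉ V) {e : E n}
    (he : e ∈ minorSet V (insert j V)) :
    IsTransversal ((minorSet V (insert j V)).erase e) ∨
      IsAlmostTransversal ((minorSet V (insert j V)).erase e) := by
  rcases E_cases e with ⟨a, rfl⟩ | ⟨a, rfl⟩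
  · rw [erase_un_minorSet]
    rw [un_mem_minorSet] at he
    exact isCoord_minorSet_insert he hj
  · rw [erase_st_minorSet]
    rw [st_mem_minorSet, mem_insert] at he
    rcases he with rfl | he
    · rw [erase_insert hj]
      exact Or.inl (isTransversal_minorSet.2 rfl)
    · have hja : j ≠ a := fun h => hj (h ▸ he)
      rw [erase_insert_of_ne hja]
      have := isCoord_minorSet_insert (V := V.erase a) (i := a) (j := j) (by simp) (by simp [hj])
      rwa [insert_erase he] at this

variable {k : Type*} [Field k]

theorem coord_of_isCoord (x : Coord n → k) {B : Finset (E n)}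
    (h : IsTransversal B ∨ IsAlmostTransversal B) : coord x B = x ⟨B, h⟩ := dif_pos h

theorem coord_plucker (L : Matrix (Fin n) (E n) k) {B : Finset (E n)}
    (h : IsTransversal B ∨ IsAlmostTransversal B) : coord (plucker L) B = maxMinor L B := by
  rw [coord_of_isCoord _ h, plucker, maxMinor_of_card]

/-- The coordinates are those of the sets `minorSet X X` and `minorSet (V + i) (V + j)`. -/
theorem coord_ext {x y : Coord n → k}
    (h1 : ∀ X, coord x (minorSet X X) = coord y (minorSet X X))
    (h2 : ∀ V i j, i ≠ j → i ∉ V → j ∉ V → coord x (minorSet (insert i V) (insert j V)) =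
      coord y (minorSet (insert i V) (insert j V))) : x = y := by
  funext ⟨B, hB⟩
  rw [← coord_of_isCoord x hB, ← coord_of_isCoord y hB]
  obtain ⟨X, Y, rfl⟩ := exists_eq_minorSet B
  rcases hB with hB | hB
  · obtain rfl := isTransversal_minorSet.1 hB
    exact h1 X
  · obtain ⟨V, i, j, hij, hi, hj, rfl, rfl⟩ := isAlmostTransversal_minorSet.1 hB
    exact h2 V i j hij hi hj

/-- The subtransversal is `minorSet (V+i+j) V`: adding the skew pair of j leaves (V+i, V+j), and
adding that of i leaves (V+j, V+i). Numbering from 0 instead of 1 changes both sides by the same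
sign. -/
theorem mem_CoordSpace_iff {x : Coord n → k} :
    x ∈ CoordSpace k n ↔ ∀ (V : Finset (Fin n)) (i j : Fin n), i ≠ j → i ∉ V → j ∉ V →
      (-1) ^ (j : ℕ) * coord x (minorSet (insert i V) (insert j V)) =
        (-1) ^ (i : ℕ) * coord x (minorSet (insert j V) (insert i V)) := by
  constructor
  · intro hx V i j hij hi hj
    have h := hx (minorSet (insert i (insert j V)) V) j i
      (isSubtransversal_minorSet.2 fun a ha => by simp [ha]) (by
        have := card_minorSet (insert i (insert j V)) V
        rw [card_insert_of_notMem (by simp [hij, hi]), card_insert_of_notMem hj] at this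
        omega) hij.symm (disjoint_skewPair_minorSet.2 (by simp [hj]))
        (disjoint_skewPair_minorSet.2 (by simp [hi]))
    rw [minorSet_union_skewPair, minorSet_union_skewPair, erase_insert_of_ne hij, erase_insert hj,
      erase_insert (by simp [hij, hi])] at h
    exact h
  · intro h S i j hS hc hij hi hj
    obtain ⟨V, hi', hj', rfl⟩ := exists_eq_minorSet_insert_insert hS hc hij hi hj
    have := h V j i hij.symm hj' hi'
    rw [minorSet_union_skewPair, minorSet_union_skewPair, erase_insert_of_ne hij,
      erase_insert hj', erase_insert (by simp [hij, hi'])]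
    exact this

end MinorSet

/-! ### Dimension of the coordinate space -/

section Dimension

variable {k : Type*} [Field k] {n : ℕ}

variable (n) in
/-- The triples `(V, i, j)` with `i < j` outside `V`: they index the pairs of almost-transversals
`minorSet (V + i) (V + j)`, `minorSet (V + j) (V + i)`. -/
abbrev PairIndex : Type :=
  {t : Finset (Fin n) × Fin n × Fin n // t.2.1 < t.2.2 ∧ t.2.1 ∉ t.1 ∧ t.2.2 ∉ t.1}

theorem card_pairIndex : Fintype.card (PairIndex n) = n.choose 2 * 2 ^ (n - 2) := by
  have hV (i j : Fin n) (h : i < j) :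
      (univ.filter fun V : Finset (Fin n) => i < j ∧ i ∉ V ∧ j ∉ V).card = 2 ^ (n - 2) := by
    have : (univ.filter fun V : Finset (Fin n) => i < j ∧ i ∉ V ∧ j ∉ V) =
        ({i, j}ᶜ : Finset (Fin n)).powerset := by
      ext V
      simp only [mem_filter, mem_univ, true_and, h, mem_powerset, subset_compl_comm (s := V)]
      simp [insert_subset_iff]
    rw [this, card_powerset, card_compl, card_pair h.ne, Fintype.card_fin]
  rw [Fintype.card_subtype, card_filter, Fintype.sum_prod_type, sum_comm,
    Fintype.sum_prod_type_right]
  have h1 (j : Fin n) : ∑ i : Fin n, ∑ V : Finset (Fin n),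
      (if i < j ∧ i ∉ V ∧ j ∉ V then 1 else 0) = (j : ℕ) * 2 ^ (n - 2) := by
    rw [← sum_subset (subset_univ (Iio j))]
    · rw [sum_congr rfl fun i hi => by rw [← card_filter, hV i j (mem_Iio.1 hi)]]
      simp
    · intro i _ hi
      rw [mem_Iio] at hi
      simp [hi]
  rw [sum_congr rfl fun j _ => h1 j, ← sum_mul, Fin.sum_univ_eq_sum_range (fun i => i),
    sum_range_id, Nat.choose_two_right]

/-- The independent coordinates on `CoordSpace`. -/
noncomputable def freeCoords :
    CoordSpace k n →ₗ[k] (Finset (Fin n) ⊕ PairIndex n → k) where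
  toFun x := Sum.elim (fun X => coord x.1 (minorSet X X))
    (fun t => coord x.1 (minorSet (insert t.1.2.1 t.1.1) (insert t.1.2.2 t.1.1)))
  map_add' x y := by
    ext (t | t) <;> simp [coord_add]
  map_smul' c x := by
    ext (t | t) <;> simp [coord_smul]

theorem freeCoords_injective : Function.Injective (freeCoords (k := k) (n := n)) := by
  rw [injective_iff_map_eq_zero]
  intro x hx
  have hx' := mem_CoordSpace_iff.1 x.2
  have h2 (V : Finset (Fin n)) (i j : Fin n) (hij : i < j) (hi : i ∉ V) (hj : j ∉ V) :
      coord x.1 (minorSet (insert i V) (insert j V)) = 0 :=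
    congrFun hx (Sum.inr ⟨(V, i, j), hij, hi, hj⟩)
  apply Subtype.ext
  apply coord_ext
  · intro X
    rw [Submodule.coe_zero, coord_zero]
    exact congrFun hx (Sum.inl X)
  · intro V i j hij hi hj
    rw [Submodule.coe_zero, coord_zero]
    rcases lt_or_gt_of_ne hij with h | h
    · exact h2 V i j h hi hj
    · have := hx' V i j hij hi hj
      rw [h2 V j i h hj hi, mul_zero] at this
      exact (mul_eq_zero.1 this).resolve_left (pow_ne_zero _ (by simp))

theorem freeCoords_surjective : Function.Surjective (freeCoords (k := k) (n := n)) := by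
  intro f
  let g (V : Finset (Fin n)) (i j : Fin n) : k :=
    if h : i < j ∧ i ∉ V ∧ j ∉ V then f (Sum.inr ⟨(V, i, j), h⟩) else 0
  -- For i > j the value is the one that the linear relation dictates from the free coordinate with
  -- i and j exchanged.
  let h (V : Finset (Fin n)) (i j : Fin n) : k :=
    if i < j then g V i j else (-1) ^ ((i : ℕ) + j) * g V j i
  -- For an almost-transversal both index sets are singletons, so the double sum just reads off i
  -- and j.
  let v (X Y : Finset (Fin n)) : k :=
    if X = Y then f (Sum.inl X) else ∑ i ∈ X \ Y, ∑ j ∈ Y \ X, h (X ∩ Y) i j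
  let x : Coord n → k := fun B =>
    v (univ.filter (fun a => un a ∉ B.1)) (univ.filter (fun a => st a ∈ B.1))
  have hx (X Y) (hB : IsTransversal (minorSet X Y) ∨ IsAlmostTransversal (minorSet X Y)) :
      coord x (minorSet X Y) = v X Y := by
    rw [coord_of_isCoord x hB]
    simp [x]
  have hX (X) : coord x (minorSet X X) = f (Sum.inl X) := by
    rw [hx _ _ (Or.inl (isTransversal_minorSet.2 rfl))]
    simp [v]
  have hV (V : Finset (Fin n)) (i j : Fin n) (hij : i ≠ j) (hi : i ∉ V) (hj : j ∉ V) :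
      coord x (minorSet (insert i V) (insert j V)) = h V i j := by
    rw [hx _ _ (isCoord_minorSet_insert hi hj)]
    have hsd {i j : Fin n} (hij : i ≠ j) (hi : i ∉ V) : insert i V \ insert j V = {i} := by
      ext a
      simp only [mem_sdiff, mem_insert, mem_singleton]
      constructor
      · tauto
      · rintro rfl; tauto
    have hne : insert i V ≠ insert j V := fun h => by
      have := hsd hij hi
      rw [h, sdiff_self] at this
      exact singleton_ne_empty _ this.symm
    have hint : insert i V ∩ insert j V = V := by
      ext a
      simp only [mem_inter, mem_insert]
      constructor
      · rintro ⟨rfl | h, rfl | h'⟩ <;> tauto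
      · tauto
    simp only [v]
    rw [if_neg hne, hsd hij hi, hsd hij.symm hj, hint, sum_singleton, sum_singleton]
  have hmem : x ∈ CoordSpace k n := by
    rw [mem_CoordSpace_iff]
    intro V i j hij hi hj
    rw [hV V i j hij hi hj, hV V j i hij.symm hj hi]
    simp only [h]
    have hsq (a : ℕ) : (-1 : k) ^ a * (-1) ^ a = 1 := by rw [← mul_pow]; simp
    rcases lt_or_gt_of_ne hij with hlt | hlt
    · rw [if_pos hlt, if_neg hlt.not_gt, pow_add]
      linear_combination (-(-1 : k) ^ (j : ℕ) * g V i j) * hsq i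
    · rw [if_pos hlt, if_neg hlt.not_gt, pow_add]
      linear_combination ((-1 : k) ^ (i : ℕ) * g V j i) * hsq j
  refine ⟨⟨x, hmem⟩, ?_⟩
  ext (X | ⟨⟨V, i, j⟩, hij, hi, hj⟩)
  · exact hX X
  · change coord x (minorSet (insert i V) (insert j V)) = _
    rw [hV V i j hij.ne hi hj]
    simp only [h, g]
    rw [if_pos hij, dif_pos ⟨hij, hi, hj⟩]

theorem finrank_CoordSpace :
    (Module.finrank k (CoordSpace k n) : ℚ) =
      (2 : ℚ) ^ ((n : ℤ) - 2) * (4 + (n.choose 2 : ℚ)) := by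
  rw [(LinearEquiv.ofBijective freeCoords
    ⟨freeCoords_injective, freeCoords_surjective⟩).finrank_eq,
    Module.finrank_fintype_fun_eq_card, Fintype.card_sum, card_pairIndex, Fintype.card_finset,
    Fintype.card_fin]
  -- For n = 0, 1 the truncated exponent n - 2 in the count of pairs is harmless, since C(n,2) = 0.
  rcases n with _ | _ | m
  · norm_num
  · norm_num
  · have : ((m + 1 + 1 : ℕ) : ℤ) - 2 = m := by push_cast; ring
    rw [this, zpow_natCast]
    push_cast
    ring

end Dimension

/-! ### Lagrangian subspaces and their nonvanishing transversals -/

section Lagrangian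

variable {k : Type*} [Field k] {n : ℕ}

variable (k n) in
/-- The standard symplectic form as a bilinear form. -/
def sympForm : LinearMap.BilinForm k (E n → k) :=
  LinearMap.mk₂ k symp
    (fun X X' Y => by
      simp only [symp, ← sum_add_distrib, Pi.add_apply]
      exact sum_congr rfl fun i _ => by ring)
    (fun c X Y => by
      simp only [symp, Pi.smul_apply, smul_eq_mul, mul_sum]
      exact sum_congr rfl fun i _ => by ring)
    (fun X Y Y' => by
      simp only [symp, ← sum_add_distrib, Pi.add_apply]
      exact sum_congr rfl fun i _ => by ring)
    (fun c X Y => by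
      simp only [symp, Pi.smul_apply, smul_eq_mul, mul_sum]
      exact sum_congr rfl fun i _ => by ring)

theorem symp_self (X : E n → k) : symp X X = 0 :=
  sum_eq_zero fun i _ => by ring

theorem symp_swap (X Y : E n → k) : symp Y X = -symp X Y := by
  rw [symp, symp, ← sum_neg_distrib]
  exact sum_congr rfl fun i _ => by ring

theorem symp_single_st (X : E n → k) (i : Fin n) : symp X (Pi.single (st i) 1) = X (un i) := by
  rw [symp, sum_eq_single i]
  · simp
  · intro j _ hj
    simp [hj]
  · simp

theorem symp_single_un (X : E n → k) (i : Fin n) : symp X (Pi.single (un i) 1) = -X (st i) := by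
  rw [symp, sum_eq_single i]
  · simp
  · intro j _ hj
    simp [hj]
  · simp

theorem sympForm_nondegenerate : (sympForm k n).Nondegenerate := by
  have h (X : E n → k) (hX : ∀ Y, symp X Y = 0) : X = 0 := by
    funext e
    rcases E_cases e with ⟨a, rfl⟩ | ⟨a, rfl⟩
    · rw [← symp_single_st X]
      exact hX _
    · have := hX (Pi.single (un a) 1)
      rw [symp_single_un] at this
      simpa using this
  refine ⟨h, fun X hX => h X fun Y => ?_⟩
  have h' : symp Y X = 0 := hX Y
  rw [symp_swap, h', neg_zero]

theorem finrank_orthogonal_add (W : Submodule k (E n → k)) :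
    Module.finrank k ((sympForm k n).orthogonal W) + Module.finrank k W = 2 * n := by
  have h1 := LinearMap.BilinForm.finrank_orthogonal (sympForm_nondegenerate (k := k) (n := n)) W
  have h2 : Module.finrank k (E n → k) = 2 * n := by
    rw [Module.finrank_fintype_fun_eq_card, Fintype.card_lex, Fintype.card_sum, Fintype.card_fin,
      two_mul]
  have h3 := Submodule.finrank_le W
  omega

theorem IsIsotropic.le_orthogonal {W : Submodule k (E n → k)} (hW : IsIsotropic W) :
    W ≤ (sympForm k n).orthogonal W := fun Y hY X hX => hW X hX Y hY

/-- If v is orthogonal to an isotropic W, then W + ⟨v⟩ is still isotropic, so maximality gives W =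
W^⊥ and dim W = n. Conversely, an isotropic subspace lies in its orthogonal complement, so its
dimension is at most n. -/
theorem isLagrangian_iff {W : Submodule k (E n → k)} :
    IsLagrangian W ↔ IsIsotropic W ∧ Module.finrank k W = n := by
  constructor
  · rintro ⟨hW, hmax⟩
    refine ⟨hW, ?_⟩
    have : (sympForm k n).orthogonal W = W := by
      refine le_antisymm (fun v hv => ?_) hW.le_orthogonal
      have hv' : ∀ X ∈ W, symp X v = 0 := hv
      have hv'' : ∀ X ∈ W, symp v X = 0 := fun X hX => by rw [symp_swap, hv' X hX, neg_zero]
      have hiso : IsIsotropic (W ⊔ Submodule.span k {v}) := by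
        intro X hX Y hY
        obtain ⟨X', hX', a, ha, rfl⟩ := Submodule.mem_sup.1 hX
        obtain ⟨Y', hY', b, hb, rfl⟩ := Submodule.mem_sup.1 hY
        obtain ⟨r, rfl⟩ := Submodule.mem_span_singleton.1 ha
        obtain ⟨s, rfl⟩ := Submodule.mem_span_singleton.1 hb
        change sympForm k n _ _ = 0
        have h1 : sympForm k n X' Y' = 0 := hW X' hX' Y' hY'
        have h2 : sympForm k n X' v = 0 := hv' X' hX'
        have h3 : sympForm k n v Y' = 0 := hv'' Y' hY'
        have h4 : sympForm k n v v = 0 := symp_self v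
        simp [h1, h2, h3, h4]
      exact hmax hiso le_sup_left (Submodule.mem_sup_right (Submodule.mem_span_singleton_self v))
    have h := finrank_orthogonal_add W
    rw [this] at h
    omega
  · rintro ⟨hW, hc⟩
    refine ⟨hW, fun W' hW' hle => ?_⟩
    have h1 := finrank_orthogonal_add W'
    have h2 := Submodule.finrank_mono hW'.le_orthogonal
    exact (Submodule.eq_of_le_of_finrank_le hle (by omega)).ge

theorem mem_rowSpace_iff {L : Matrix (Fin n) (E n) k} {w : E n → k} :
    w ∈ rowSpace L ↔ ∃ c : Fin n → k, ∀ e, w e = ∑ a, c a * L a e := by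
  rw [rowSpace, Submodule.mem_span_range_iff_exists_fun]
  refine exists_congr fun c => ?_
  rw [funext_iff]
  refine forall_congr' fun e => ?_
  rw [Finset.sum_apply, eq_comm]
  rfl

theorem row_mem_rowSpace (L : Matrix (Fin n) (E n) k) (a : Fin n) : L a ∈ rowSpace L :=
  Submodule.subset_span ⟨a, rfl⟩

theorem isIsotropic_rowSpace {L : Matrix (Fin n) (E n) k} (h : ∀ a b, symp (L a) (L b) = 0) :
    IsIsotropic (rowSpace L) := by
  intro X hX Y hY
  change sympForm k n X Y = 0
  induction hX using Submodule.span_induction with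
  | mem X hX =>
    obtain ⟨a, rfl⟩ := hX
    induction hY using Submodule.span_induction with
    | mem Y hY =>
      obtain ⟨b, rfl⟩ := hY
      exact h a b
    | zero => simp
    | add Y Y' _ _ h h' => rw [map_add, h, h', add_zero]
    | smul c Y _ h => rw [map_smul, h, smul_zero]
  | zero => simp
  | add Y Y' _ _ h h' => rw [map_add, LinearMap.add_apply, h, h', add_zero]
  | smul c Y _ h => rw [map_smul, LinearMap.smul_apply, h, smul_zero]

theorem linearIndependent_row {L : Matrix (Fin n) (E n) k}
    (h : Module.finrank k (rowSpace L) = n) : LinearIndependent k L.row := by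
  rw [linearIndependent_iff_card_eq_finrank_span, Fintype.card_fin]
  exact h.symm

theorem finrank_rowSpace {L : Matrix (Fin n) (E n) k} {c : Fin n → E n}
    (h : (L.submatrix id c).det ≠ 0) : Module.finrank k (rowSpace L) = n := by
  have : LinearIndependent k L.row := by
    rw [Fintype.linearIndependent_iff]
    intro g hg
    have h2 : Matrix.vecMul g (L.submatrix id c) = 0 := by
      ext t
      have := congrFun hg (c t)
      rw [Finset.sum_apply] at this
      exact this
    exact congrFun (Matrix.eq_zero_of_vecMul_eq_zero h h2)
  rw [rowSpace, finrank_span_eq_card this, Fintype.card_fin]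

/-- A Lagrangian subspace maps isomorphically to the coordinates in some transversal. -/
theorem exists_transversal_of_isLagrangian {W : Submodule k (E n → k)} (hW : IsLagrangian W) :
    ∃ X : Finset (Fin n), ∀ w ∈ W, (∀ e ∈ minorSet X X, w e = 0) → w = 0 := by
  classical
  obtain ⟨hiso, hdim⟩ := isLagrangian_iff.1 hW
  -- S contains no skew pair and W surjects onto k^S. A largest such S turns out to be the
  -- transversal sought.
  let P (S : Finset (E n)) : Prop := (∀ e ∈ S, star e ∉ S) ∧
    ∀ g : E n → k, ∃ w ∈ W, ∀ e ∈ S, w e = g e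
  obtain ⟨S, hS, hmax⟩ := exists_max_image (univ.filter P) card
    ⟨∅, mem_filter.2 ⟨mem_univ _, by simp, fun g => ⟨0, W.zero_mem, by simp⟩⟩⟩
  obtain ⟨hS1, hS2⟩ := (mem_filter.1 hS).2
  -- If w vanished on S but not at e, multiples of w would adjust the value at e freely without
  -- changing values on S, so S + e would contradict maximality.
  have hout (w) (hw : w ∈ W) (h0 : ∀ e ∈ S, w e = 0) (e) (he : e ∉ S) (he' : star e ∉ S) :
      w e = 0 := by
    by_contra hne
    have hP : P (insert e S) := by
      constructor
      · intro f hf hf'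
        rcases mem_insert.1 hf with rfl | hf
        · rcases mem_insert.1 hf' with h | h
          · rcases E_cases f with ⟨a, rfl⟩ | ⟨a, rfl⟩ <;> simp at h
          · exact he' h
        · rcases mem_insert.1 hf' with h | h
          · exact he' (by rw [← h, star_star]; exact hf)
          · exact hS1 f hf h
      · intro g
        obtain ⟨v, hv, hvg⟩ := hS2 g
        refine ⟨v + ((g e - v e) / w e) • w, W.add_mem hv (W.smul_mem _ hw), fun f hf => ?_⟩
        rcases mem_insert.1 hf with rfl | hf
        · simp [hne]
        · simp [h0 f hf, hvg f hf]
    have := hmax _ (mem_filter.2 ⟨mem_univ _, hP⟩)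
    rw [card_insert_of_notMem he] at this
    omega
  -- Pair w with a v in W that restricts on S to the indicator of s. The skew pair of s contributes
  -- ±w(s*). Any other pair contributes 0: v and w both vanish at its element in S, or it misses S
  -- and w vanishes on it by `hout`.
  have hin (w) (hw : w ∈ W) (h0 : ∀ e ∈ S, w e = 0) (s) (hs : s ∈ S) : w (star s) = 0 := by
    obtain ⟨v, hv, hvg⟩ := hS2 (Pi.single s 1)
    have hz := hiso v hv w hw
    have hterm (i : Fin n) (h1 : s ≠ un i) (h2 : s ≠ st i) :
        v (un i) * w (st i) - v (st i) * w (un i) = 0 := by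
      by_cases hu : un i ∈ S
      · rw [h0 _ hu, hvg _ hu, Pi.single_eq_of_ne h1.symm]; ring
      · by_cases ht : st i ∈ S
        · rw [h0 _ ht, hvg _ ht, Pi.single_eq_of_ne h2.symm]; ring
        · rw [hout w hw h0 (un i) hu ht, hout w hw h0 (st i) ht hu]; ring
    rcases E_cases s with ⟨a, rfl⟩ | ⟨a, rfl⟩
    · rw [symp, sum_eq_single a (fun i _ hi => hterm i (by simpa using hi.symm) (by simp))
        (by simp), hvg _ hs, h0 _ hs] at hz
      simpa using hz
    · rw [symp, sum_eq_single a (fun i _ hi => hterm i (by simp) (by simpa using hi.symm))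
        (by simp), hvg _ hs, h0 _ hs] at hz
      simpa using hz
  have hinj (w) (hw : w ∈ W) (h0 : ∀ e ∈ S, w e = 0) : w = 0 := by
    funext e
    by_cases he : e ∈ S
    · exact h0 e he
    · by_cases he' : star e ∈ S
      · have := hin w hw h0 _ he'
        rwa [star_star] at this
      · exact hout w hw h0 e he he'
  let ρ : W →ₗ[k] (S → k) :=
    { toFun := fun w e => w.1 e.1
      map_add' := fun _ _ => rfl
      map_smul' := fun _ _ => rfl }
  have hρ : Function.Bijective ρ := by
    constructor
    · rw [injective_iff_map_eq_zero]
      intro w hw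
      exact Subtype.ext (hinj w.1 w.2 fun e he => congrFun hw ⟨e, he⟩)
    · intro g
      obtain ⟨w, hw, h⟩ := hS2 (fun e => if h : e ∈ S then g ⟨e, h⟩ else 0)
      refine ⟨⟨w, hw⟩, ?_⟩
      funext e
      change w e.1 = g e
      rw [h e.1 e.2, dif_pos e.2]
  have hcard : S.card = n := by
    have := (LinearEquiv.ofBijective ρ hρ).finrank_eq
    rw [hdim, Module.finrank_fintype_fun_eq_card, Fintype.card_coe] at this
    exact this.symm
  have hT : IsTransversal S := by
    refine ⟨hcard, ?_⟩
    rw [card_eq_zero, eq_empty_iff_forall_notMem]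
    intro e he
    rw [mem_inter, mem_image] at he
    obtain ⟨he, f, hf, rfl⟩ := he
    exact hS1 f hf he
  obtain ⟨X, Y, rfl⟩ := exists_eq_minorSet S
  obtain rfl := isTransversal_minorSet.1 hT
  exact ⟨X, hinj⟩

/-- A vanishing minor would give a nontrivial combination of rows that vanishes on the transversal,
hence everywhere, against the independence of the rows. -/
theorem exists_maxMinor_ne_zero {L : Matrix (Fin n) (E n) k} (hL : IsLagrangian (rowSpace L)) :
    ∃ X : Finset (Fin n), maxMinor L (minorSet X X) ≠ 0 := by
  obtain ⟨X, hX⟩ := exists_transversal_of_isLagrangian hL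
  refine ⟨X, fun h => ?_⟩
  have hc : (minorSet X X).card = n := by
    have := card_minorSet X X
    omega
  rw [maxMinor_of_card _ _ hc] at h
  obtain ⟨c, hc0, hcL⟩ := Matrix.exists_vecMul_eq_zero_iff.2 h
  apply hc0
  have hw : (fun e => ∑ a, c a * L a e) = 0 := by
    refine hX _ (mem_rowSpace_iff.2 ⟨c, fun e => rfl⟩) fun e he => ?_
    have : e ∈ Set.range ((minorSet X X).orderEmbOfFin hc) := by
      rw [range_orderEmbOfFin]; exact he
    obtain ⟨t, rfl⟩ := this
    have := congrFun hcL t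
    simpa only [Matrix.vecMul, dotProduct, Matrix.submatrix_apply, id, Pi.zero_apply] using this
  have hw' : ∑ a, c a • L.row a = 0 := by
    funext e
    rw [Finset.sum_apply]
    exact congrFun hw e
  have hrow : LinearIndependent k L.row := linearIndependent_row (isLagrangian_iff.1 hL).2
  have hli := Fintype.linearIndependent_iff.1 hrow
  exact funext (hli c hw')

/-- Every Lagrangian subspace is the row space of an `n × E` matrix. -/
theorem exists_rowSpace_eq {W : Submodule k (E n → k)} (hW : IsLagrangian W) :
    ∃ L : Matrix (Fin n) (E n) k, rowSpace L = W := by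
  let b := Module.finBasisOfFinrankEq k W (isLagrangian_iff.1 hW).2
  let L : Matrix (Fin n) (E n) k := Matrix.of fun a => (b a).1
  have : Set.range L.row = W.subtype '' Set.range b := by
    rw [← Set.range_comp]
    rfl
  exact ⟨L, by rw [rowSpace, this, Submodule.span_image, b.span_eq, Submodule.map_subtype_top]⟩

end Lagrangian

/-! ### Linear and quadratic relations between the coordinates -/

section Relations

variable {k : Type*} [Field k] {n : ℕ}

theorem smaller_compl (Z : Finset (Fin n)) (i : Fin n) : smaller Zᶜ i + smaller Z i = i := by
  have h := smaller_sdiff univ Z (subset_univ Z) i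
  rw [← compl_eq_univ_sdiff] at h
  rw [h, smaller, ← Fin.card_Iio i]
  congr 1
  ext a
  simp

/-- The parity that governs the linear relations between the coordinates. -/
theorem smaller_un_add_smaller_st {V : Finset (Fin n)} {i j : Fin n} (hj : j ∉ V) :
    smaller (minorSet (insert i (insert j V)) V) (un i) +
      smaller (minorSet (insert i (insert j V)) V) (st i) + (if j < i then 1 else 0) =
      (insert i (insert j V))ᶜ.card + i := by
  rw [smaller_minorSet_un, smaller_minorSet_st]
  have h1 := smaller_compl (insert i (insert j V)) i
  rw [smaller_insert_self, smaller_insert V hj] at h1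
  omega

theorem neg_one_pow_mul_self (a : ℕ) : (-1 : k) ^ a * (-1) ^ a = 1 := by
  rw [← mul_pow]; simp

/-- Isotropy of the rows says that the array ∑_l L(a, l) L(b, l*) is symmetric in a and b, so it
pairs to 0 with the alternating array of double expansions at S. The alternating condition includes
a zero diagonal, so characteristic 2 is covered. -/
theorem plucker_mem_CoordSpace {L : Matrix (Fin n) (E n) k} (hL : IsIsotropic (rowSpace L)) :
    plucker L ∈ CoordSpace k n := by
  rw [mem_CoordSpace_iff]
  intro V i j hij hi hj
  set S := minorSet (insert i (insert j V)) V with hS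
  have hcard : S.card + 2 = n := by
    have := card_minorSet (insert i (insert j V)) V
    rw [← hS, card_insert_of_notMem (by simp [hij, hi]), card_insert_of_notMem hj] at this
    omega
  obtain ⟨M, hM0, hM1, hMS, hM⟩ := exists_alternating_eq_minor L S hcard
  have hsum : ∑ l : Fin n, ∑ a, ∑ b, M a b * (L a (un l) * L b (st l)) = 0 := by
    have := sum_alternating_mul_symmetric M (fun a b => ∑ l : Fin n, L a (un l) * L b (st l))
      hM0 hM1 (fun a b => by
        have h := hL _ (row_mem_rowSpace L a) _ (row_mem_rowSpace L b)
        rw [symp, sum_sub_distrib, sub_eq_zero] at h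
        rw [h]
        exact sum_congr rfl fun l _ => mul_comm _ _)
    rw [← this, sum_comm]
    refine sum_congr rfl fun a _ => ?_
    rw [sum_comm]
    exact sum_congr rfl fun b _ => by rw [mul_sum]
  have hterm (l : Fin n) (hu : un l ∉ S) (hs : st l ∉ S) :
      ∑ a, ∑ b, M a b * (L a (un l) * L b (st l)) =
        (-1) ^ (smaller S (un l) + smaller S (st l)) *
          maxMinor L (insert (un l) (insert (st l) S)) := by
    rw [hM _ _ hu hs un_ne_st, smaller_insert S hs, if_neg not_st_lt_un, add_zero, add_comm]
  rw [← sum_subset (subset_univ {i, j})] at hsum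
  · rw [sum_pair hij, hterm i (by simp [hS]) (by simp [hS, hi]), hterm j (by simp [hS])
      (by simp [hS, hj])] at hsum
    have e1 : insert (un i) (insert (st i) S) = minorSet (insert j V) (insert i V) := by
      rw [hS, insert_st_minorSet, insert_un_minorSet, erase_insert (by simp [hij, hi])]
    have e2 : insert (un j) (insert (st j) S) = minorSet (insert i V) (insert j V) := by
      rw [hS, insert_st_minorSet, insert_un_minorSet, insert_comm,
        erase_insert (by simp [hij.symm, hj])]
    rw [coord_plucker _ (isCoord_minorSet_insert hi hj),
      coord_plucker _ (isCoord_minorSet_insert hj hi)]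
    rw [e1, e2] at hsum
    have p1 := smaller_un_add_smaller_st (i := i) hj
    have p2 := smaller_un_add_smaller_st (i := j) hi
    rw [insert_comm j i] at p2
    rw [← hS] at p1 p2
    set q := (insert i (insert j V))ᶜ.card
    have hq := neg_one_pow_mul_self (k := k) q
    rcases lt_or_gt_of_ne hij with h | h
    · rw [if_neg h.not_gt, add_zero] at p1
      rw [if_pos h] at p2
      have p2' : (-1 : k) ^ (smaller S (un j) + smaller S (st j)) = -(-1) ^ (q + (j : ℕ)) := by
        rw [← p2, pow_succ]; ring
      rw [p1, p2', pow_add, pow_add] at hsum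
      linear_combination (-(-1 : k) ^ q) * hsum +
        ((-1) ^ (i : ℕ) * maxMinor L (minorSet (insert j V) (insert i V)) -
          (-1) ^ (j : ℕ) * maxMinor L (minorSet (insert i V) (insert j V))) * hq
    · rw [if_neg h.not_gt, add_zero] at p2
      rw [if_pos h] at p1
      have p1' : (-1 : k) ^ (smaller S (un i) + smaller S (st i)) = -(-1) ^ (q + (i : ℕ)) := by
        rw [← p1, pow_succ]; ring
      rw [p2, p1', pow_add, pow_add] at hsum
      linear_combination ((-1 : k) ^ q) * hsum +
        ((-1) ^ (i : ℕ) * maxMinor L (minorSet (insert j V) (insert i V)) -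
          (-1) ^ (j : ℕ) * maxMinor L (minorSet (insert i V) (insert j V))) * hq
  -- For every other l, one of l, l* already lies in S, so the term has a repeated column.
  · intro l _ hl
    simp only [mem_insert, mem_singleton, not_or] at hl
    apply hMS
    by_cases hlV : l ∈ V
    · exact Or.inr (by simp [hS, hlV])
    · exact Or.inl (by simp [hS, hlV, hl.1, hl.2])

/-- The vector `e ↦ (-1)^{|T_{<e}|} x_{T + e}`. -/
noncomputable def cocircuit (x : Coord n → k) (T : Finset (E n)) (e : E n) : k :=
  if e ∈ T then 0 else (-1) ^ smaller T e * coord x (insert e T)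

theorem cocircuit_of_mem (x : Coord n → k) {T : Finset (E n)} {e : E n} (h : e ∈ T) :
    cocircuit x T e = 0 := if_pos h

theorem cocircuit_of_notMem (x : Coord n → k) {T : Finset (E n)} {e : E n} (h : e ∉ T) :
    cocircuit x T e = (-1) ^ smaller T e * coord x (insert e T) := if_neg h

theorem cocircuit_plucker (L : Matrix (Fin n) (E n) k) {U : Finset (Fin n)} {i : Fin n}
    (hi : i ∉ U) : ∃ c : Fin n → k, ∀ e,
      cocircuit (plucker L) (minorSet (insert i U) U) e = ∑ a, c a * L a e := by
  have hc : (minorSet (insert i U) U).card + 1 = n := by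
    have := card_minorSet (insert i U) U
    rw [card_insert_of_notMem hi] at this
    omega
  obtain ⟨c, h⟩ := exists_comb_eq_minor L _ hc
  refine ⟨c, fun e => ?_⟩
  rw [h, cocircuit]
  split_ifs with he
  · rfl
  · rw [coord_plucker _ (isCoord_insert hi he)]

theorem cocircuit_plucker_mem (L : Matrix (Fin n) (E n) k) {U : Finset (Fin n)} {i : Fin n}
    (hi : i ∉ U) : cocircuit (plucker L) (minorSet (insert i U) U) ∈ rowSpace L :=
  mem_rowSpace_iff.2 (cocircuit_plucker L hi)

theorem rgp_eq_sum_cocircuit (x : Coord n → k) (S T : Finset (E n)) :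
    rgp x S T = ∑ e ∈ S, (-1) ^ smaller S e * coord x (S.erase e) * cocircuit x T e := by
  rw [rgp, ← sum_subset (sdiff_subset (s := S) (t := T))]
  · refine sum_congr rfl fun e he => ?_
    rw [cocircuit_of_notMem x (mem_sdiff.1 he).2, pow_add]
    ring
  · intro e he he'
    have : e ∈ T := by
      by_contra h
      exact he' (mem_sdiff.2 ⟨he, h⟩)
    rw [cocircuit_of_mem x this, mul_zero]

/-- The vector of minors at T + e is a combination of rows, and every row is annihilated by the
signed minors at S - e. -/
theorem rgp_plucker (L : Matrix (Fin n) (E n) k) {S T : Finset (E n)} (h : IsRGPIndex S T) :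
    rgp (plucker L) S T = 0 := by
  have hc := h.1
  obtain ⟨V, j, U, i, hj, hi, rfl, rfl⟩ := isRGPIndex_iff.1 h
  obtain ⟨c, hcc⟩ := cocircuit_plucker L hi
  rw [rgp_eq_sum_cocircuit]
  have h1 (e) (he : e ∈ minorSet V (insert j V)) :
      (-1) ^ smaller (minorSet V (insert j V)) e *
        coord (plucker L) ((minorSet V (insert j V)).erase e) *
        cocircuit (plucker L) (minorSet (insert i U) U) e =
      ∑ a, c a * ((-1) ^ smaller (minorSet V (insert j V)) e *
        maxMinor L ((minorSet V (insert j V)).erase e) * L a e) := by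
    rw [hcc, coord_plucker _ (isCoord_erase hj he), mul_sum]
    exact sum_congr rfl fun a _ => by ring
  rw [sum_congr rfl h1, sum_comm]
  refine sum_eq_zero fun a _ => ?_
  rw [← mul_sum, sum_minor_mul_eq_zero L _ hc, mul_zero]

theorem rgp_smul (c : k) (x : Coord n → k) (S T : Finset (E n)) :
    rgp (c • x) S T = c ^ 2 * rgp x S T := by
  rw [rgp, rgp, mul_sum]
  refine sum_congr rfl fun e _ => ?_
  rw [coord_smul, coord_smul]
  ring

theorem cocircuit_smul (c : k) (x : Coord n → k) (T : Finset (E n)) :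
    cocircuit (c • x) T = c • cocircuit x T := by
  funext e
  rw [Pi.smul_apply, cocircuit, cocircuit, coord_smul, smul_eq_mul]
  split_ifs <;> ring

/-- A nonzero solution of the restricted relations has a nonzero coordinate at a transversal. -/
theorem exists_coord_transversal_ne_zero {x : Coord n → k} (hx : x ∈ CoordSpace k n)
    (hx0 : x ≠ 0) (hr : ∀ S T, IsRGPIndex S T → rgp x S T = 0) :
    ∃ X, coord x (minorSet X X) ≠ 0 := by
  by_contra! hX
  apply hx0
  apply coord_ext
  · intro X
    rw [hX, coord_zero]
  · intro V i j hij hi hj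
    rw [coord_zero]
    -- Here S \ T consists of i, j and j*. Removing j or j* from S leaves a transversal, where x
    -- vanishes. The term at i is ± the product of the two linked coordinates, and the linear
    -- relation makes both of them zero once one is.
    have h := hr (minorSet V (insert j V)) (minorSet (insert j (insert i V)) (insert i V))
      (isRGPIndex_iff.2 ⟨V, j, insert i V, j, hj, by simp [hij.symm, hj], rfl, rfl⟩)
    rw [rgp, sum_eq_single (un i)] at h
    · rw [erase_un_minorSet, insert_un_minorSet, insert_comm j i,
        erase_insert (by simp [hij, hi]), mul_assoc] at h
      have h2 := (mul_eq_zero.1 h).resolve_left (pow_ne_zero _ (by simp))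
      rcases mul_eq_zero.1 h2 with h2 | h2
      · exact h2
      · have h3 := mem_CoordSpace_iff.1 hx V i j hij hi hj
        rw [h2, mul_zero] at h3
        exact (mul_eq_zero.1 h3).resolve_left (pow_ne_zero _ (by simp))
    · intro e he hne
      rw [mem_sdiff] at he
      rcases E_cases e with ⟨a, rfl⟩ | ⟨a, rfl⟩
      · have hai : a ≠ i := fun h => hne (by rw [h])
        have : a = j := by
          simp only [un_mem_minorSet, mem_insert] at he
          tauto
        subst this
        rw [erase_un_minorSet, hX]
        ring
      · have : a = j := by
          simp only [st_mem_minorSet, mem_insert] at he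
          tauto
        subst this
        rw [erase_st_minorSet, erase_insert hj, hX]
        ring
    · intro hne
      exfalso
      apply hne
      simp [hi]

/-- The index of a relation that expresses the coordinate at `B` by coordinates closer to the
transversal `minorSet X X`. -/
theorem exists_isRGPIndex {X : Finset (Fin n)} {B : Finset (E n)}
    (hB : IsTransversal B ∨ IsAlmostTransversal B) (hne : B ≠ minorSet X X) :
    ∃ f ∈ minorSet X X, f ∉ B ∧ IsRGPIndex (insert f B) ((minorSet X X).erase f) := by
  have hun (a) (ha : a ∉ X) : ∃ U i, i ∉ U ∧
      (minorSet X X).erase (un a) = minorSet (insert i U) U :=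
    ⟨X, a, ha, erase_un_minorSet X X a⟩
  have hst (a) (ha : a ∈ X) : ∃ U i, i ∉ U ∧
      (minorSet X X).erase (st a) = minorSet (insert i U) U :=
    ⟨X.erase a, a, by simp, by rw [erase_st_minorSet, insert_erase ha]⟩
  have key (f) (hf : f ∈ minorSet X X) (hfB : f ∉ B)
      (h : ∃ V j, j ∉ V ∧ insert f B = minorSet V (insert j V)) :
      ∃ f ∈ minorSet X X, f ∉ B ∧ IsRGPIndex (insert f B) ((minorSet X X).erase f) := by
    obtain ⟨V, j, hj, hV⟩ := h
    refine ⟨f, hf, hfB, isRGPIndex_iff.2 ?_⟩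
    rcases E_cases f with ⟨a, rfl⟩ | ⟨a, rfl⟩
    · obtain ⟨U, i, hi, hU⟩ := hun a (un_mem_minorSet.1 hf)
      exact ⟨V, j, U, i, hj, hi, hV, hU⟩
    · obtain ⟨U, i, hi, hU⟩ := hst a (st_mem_minorSet.1 hf)
      exact ⟨V, j, U, i, hj, hi, hV, hU⟩
  obtain ⟨Y, Z, rfl⟩ := exists_eq_minorSet B
  rcases hB with hB | hB
  · obtain rfl := isTransversal_minorSet.1 hB
    have hYX : Y ≠ X := fun h => hne (by rw [h])
    have : ∃ a, ¬ (a ∈ Y ↔ a ∈ X) := by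
      by_contra! h
      exact hYX (ext h)
    obtain ⟨a, ha⟩ := this
    by_cases haX : a ∈ X
    · have haY : a ∉ Y := by tauto
      exact key (st a) (by simpa using haX) (by simpa using haY)
        ⟨Y, a, haY, insert_st_minorSet Y Y a⟩
    · have haY : a ∈ Y := by tauto
      exact key (un a) (by simpa using haX) (by simpa using haY)
        ⟨Y.erase a, a, by simp, by rw [insert_un_minorSet, insert_erase haY]⟩
  -- B misses the skew pair of i altogether, so adding the element of that pair in `minorSet X X`
  -- creates no second skew pair.
  · obtain ⟨V, i, j, hij, hi, hj, rfl, rfl⟩ := isAlmostTransversal_minorSet.1 hB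
    by_cases hiX : i ∈ X
    · exact key (st i) (by simpa using hiX) (by simp [hij, hi])
        ⟨insert i V, j, by simp [hij.symm, hj], by rw [insert_st_minorSet, insert_comm]⟩
    · exact key (un i) (by simpa using hiX) (by simp)
        ⟨V, j, hj, by rw [insert_un_minorSet, erase_insert hi]⟩

/-- A solution of the restricted relations is determined by the coordinates at distance at most
`1` from a transversal at which it does not vanish. -/
theorem eq_of_coord_eq_near {x y : Coord n → k} {X : Finset (Fin n)}
    (hx : ∀ S T, IsRGPIndex S T → rgp x S T = 0) (hy : ∀ S T, IsRGPIndex S T → rgp y S T = 0)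
    (h0 : coord x (minorSet X X) ≠ 0) (h1 : coord x (minorSet X X) = coord y (minorSet X X))
    (h2 : ∀ f ∈ minorSet X X, ∀ e, e ∉ minorSet X X →
      coord x (insert e ((minorSet X X).erase f)) = coord y (insert e ((minorSet X X).erase f))) :
    x = y := by
  -- Induction on the number of elements of the transversal that B lacks.
  suffices h : ∀ m (B : Finset (E n)), (minorSet X X \ B).card = m → coord x B = coord y B from
    coord_ext (fun _ => h _ _ rfl) (fun _ _ _ _ _ _ => h _ _ rfl)
  intro m
  induction m using Nat.strong_induction_on with
  | _ m ih =>
    intro B hm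
    by_cases hB : IsTransversal B ∨ IsAlmostTransversal B
    swap
    · rw [coord, coord, dif_neg hB, dif_neg hB]
    by_cases hBX : B = minorSet X X
    · rw [hBX, h1]
    obtain ⟨f, hf, hfB, hind⟩ := exists_isRGPIndex hB hBX
    have hfmem : f ∈ insert f B \ (minorSet X X).erase f := by simp
    have ex := hx _ _ hind
    have ey := hy _ _ hind
    rw [rgp, ← add_sum_erase _ _ hfmem] at ex ey
    have hrest : ∀ e ∈ (insert f B \ (minorSet X X).erase f).erase f,
        (-1) ^ (smaller (insert f B) e + smaller ((minorSet X X).erase f) e) *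
          coord x ((insert f B).erase e) * coord x (insert e ((minorSet X X).erase f)) =
        (-1) ^ (smaller (insert f B) e + smaller ((minorSet X X).erase f) e) *
          coord y ((insert f B).erase e) * coord y (insert e ((minorSet X X).erase f)) := by
      intro e he
      simp only [mem_erase, mem_sdiff, mem_insert, not_and] at he
      obtain ⟨hef, heB, heX⟩ := he
      have heX' : e ∉ minorSet X X := heX hef
      -- B + f - e gains f from the transversal and loses only e outside it, so it is closer; the
      -- other factor is a near coordinate. The omitted term e = f is ±x_B times the nonzero
      -- coordinate.
      rw [h2 f hf e heX', ih _ ?_ _ rfl]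
      rw [← hm]
      apply card_lt_card
      rw [ssubset_iff_of_subset]
      · exact ⟨f, by simp [hf, hfB], by simp [hef.symm]⟩
      · intro a ha
        simp only [mem_sdiff, mem_erase, mem_insert, not_and, not_or] at ha ⊢
        exact ⟨ha.1, (ha.2 fun h => heX' (h ▸ ha.1)).2⟩
    rw [sum_congr rfl hrest, erase_insert hfB, insert_erase hf] at ex
    rw [erase_insert hfB, insert_erase hf, ← h1] at ey
    have h3 : (-1) ^ (smaller (insert f B) f + smaller ((minorSet X X).erase f) f) *
        coord x (minorSet X X) * (coord x B - coord y B) = 0 := by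
      linear_combination ex - ey
    exact sub_eq_zero.1 ((mul_eq_zero.1 h3).resolve_left
      (mul_ne_zero (pow_ne_zero _ (by simp)) h0))

end Relations

/-! ### Reconstruction of the subspace from its coordinates -/

section Parameterization

variable {k : Type*} [Field k] {n : ℕ}

/-- The element of the skew pair of `l` in the transversal `minorSet X X`. -/
def pick (X : Finset (Fin n)) (l : Fin n) : E n := if l ∈ X then st l else un l

theorem pick_of_mem {X : Finset (Fin n)} {l : Fin n} (h : l ∈ X) : pick X l = st l := if_pos h

theorem pick_of_notMem {X : Finset (Fin n)} {l : Fin n} (h : l ∉ X) : pick X l = un l := if_neg h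

theorem pick_mem (X : Finset (Fin n)) (l : Fin n) : pick X l ∈ minorSet X X := by
  by_cases h : l ∈ X
  · simp [pick_of_mem h, h]
  · simp [pick_of_notMem h, h]

theorem exists_eq_pick {X : Finset (Fin n)} {e : E n} (he : e ∈ minorSet X X) :
    ∃ l, e = pick X l := by
  rcases E_cases e with ⟨a, rfl⟩ | ⟨a, rfl⟩
  · exact ⟨a, (pick_of_notMem (un_mem_minorSet.1 he)).symm⟩
  · exact ⟨a, (pick_of_mem (st_mem_minorSet.1 he)).symm⟩

theorem pick_injective (X : Finset (Fin n)) : Function.Injective (pick X) := by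
  intro a b h
  by_cases ha : a ∈ X <;> by_cases hb : b ∈ X <;> simp [pick, ha, hb] at h <;> exact h

theorem star_pick_notMem (X : Finset (Fin n)) (l : Fin n) : star (pick X l) ∉ minorSet X X := by
  by_cases h : l ∈ X
  · simp [pick_of_mem h, h]
  · simp [pick_of_notMem h, h]

theorem erase_pick (X : Finset (Fin n)) (l : Fin n) :
    ∃ U i, i ∉ U ∧ (minorSet X X).erase (pick X l) = minorSet (insert i U) U := by
  by_cases h : l ∈ X
  · exact ⟨X.erase l, l, by simp, by rw [pick_of_mem h, erase_st_minorSet, insert_erase h]⟩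
  · exact ⟨X, l, h, by rw [pick_of_notMem h, erase_un_minorSet]⟩

theorem symp_eq_sum_pick (X : Finset (Fin n)) (v w : E n → k) :
    symp v w = ∑ l, (if l ∈ X then (-1 : k) else 1) *
      (v (pick X l) * w (star (pick X l)) - v (star (pick X l)) * w (pick X l)) := by
  refine sum_congr rfl fun l _ => ?_
  split_ifs with h
  · rw [pick_of_mem h, star_st]; ring
  · rw [pick_of_notMem h, star_un]; ring

theorem cocircuit_erase_self (x : Coord n → k) (X : Finset (Fin n)) (l : Fin n) :
    cocircuit x ((minorSet X X).erase (pick X l)) (pick X l) =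
      (-1) ^ smaller (minorSet X X) (pick X l) * coord x (minorSet X X) := by
  rw [cocircuit_of_notMem x (by simp), insert_erase (pick_mem X l), smaller_erase_self]

theorem cocircuit_erase_of_ne (x : Coord n → k) (X : Finset (Fin n)) {l l' : Fin n} (h : l ≠ l') :
    cocircuit x ((minorSet X X).erase (pick X l)) (pick X l') = 0 :=
  cocircuit_of_mem x (mem_erase.2 ⟨fun e => h (pick_injective X e).symm, pick_mem X l'⟩)

/-- The `n × E` matrix whose rows are the vectors `cocircuit x (minorSet X X - f)`. -/
noncomputable def cocircuitMatrix (x : Coord n → k) (X : Finset (Fin n)) :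
    Matrix (Fin n) (E n) k :=
  Matrix.of fun l => cocircuit x ((minorSet X X).erase (pick X l))

theorem erase_erase_pick (X : Finset (Fin n)) {l l' : Fin n} :
    ((minorSet X X).erase (pick X l')).erase (pick X l) =
      minorSet (insert l (insert l' ((X.erase l).erase l'))) ((X.erase l).erase l') := by
  have hu (a b) : un a = pick X b ↔ a = b ∧ b ∉ X := by
    by_cases hb : b ∈ X <;> simp [pick, hb]
  have hs (a b) : st a = pick X b ↔ a = b ∧ b ∈ X := by
    by_cases hb : b ∈ X <;> simp [pick, hb]
  apply ext_E
  · intro a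
    simp only [mem_erase, ne_eq, hu, un_mem_minorSet, mem_insert]
    grind
  · intro a
    simp only [mem_erase, ne_eq, hs, st_mem_minorSet]
    grind

/-- Exchanging l and l' gives the partner almost-transversal in a linear relation; this is how the
linear relations enter the pairing of two rows. -/
theorem insert_star_erase_pick (X : Finset (Fin n)) {l l' : Fin n} (h : l ≠ l') :
    insert (star (pick X l)) ((minorSet X X).erase (pick X l')) =
      minorSet (insert l' ((X.erase l).erase l')) (insert l ((X.erase l).erase l')) := by
  have h1 : pick X l ∈ (minorSet X X).erase (pick X l') :=
    mem_erase.2 ⟨fun e => h (pick_injective X e), pick_mem X l⟩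
  rw [← insert_erase h1, erase_erase_pick]
  by_cases hl : l ∈ X
  · rw [pick_of_mem hl, star_st, insert_st_minorSet, insert_un_minorSet, erase_insert (by simp [h])]
  · rw [pick_of_notMem hl, star_un, insert_un_minorSet, insert_st_minorSet,
      erase_insert (by simp [h])]

/-- The sign of the product of entries in the symplectic pairing of two rows. -/
theorem sign_cocircuit_pairing (X : Finset (Fin n)) {l l' : Fin n} (h : l ≠ l') :
    (if l ∈ X then (-1 : k) else 1) * (-1) ^ smaller (minorSet X X) (pick X l) *
      (-1) ^ smaller ((minorSet X X).erase (pick X l')) (star (pick X l)) =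
    -(-1) ^ ((insert l (insert l' ((X.erase l).erase l')))ᶜ.card + (l : ℕ) +
      (if l' < l then 1 else 0) + (if pick X l' < pick X l then 1 else 0)) := by
  set V := (X.erase l).erase l' with hV
  set S := minorSet (insert l (insert l' V)) V with hS
  have h1 : pick X l ∈ (minorSet X X).erase (pick X l') :=
    mem_erase.2 ⟨fun e => h (pick_injective X e), pick_mem X l⟩
  have e1 : (minorSet X X).erase (pick X l') = insert (pick X l) S := by
    rw [hS, hV, ← erase_erase_pick, insert_erase h1]
  have e2 : minorSet X X = insert (pick X l') (insert (pick X l) S) := by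
    rw [← e1, insert_erase (pick_mem X l')]
  have n1 : pick X l ∉ S := by
    rw [hS, hV, ← erase_erase_pick]; simp
  have n2 : pick X l' ∉ insert (pick X l) S := by
    rw [← e1]; simp
  have p := smaller_un_add_smaller_st (V := V) (i := l) (j := l') (by simp [hV])
  rw [← hS] at p
  rw [e1, smaller_insert S n1]
  have e3 : smaller (minorSet X X) (pick X l) =
      smaller S (pick X l) + if pick X l' < pick X l then 1 else 0 := by
    rw [e2, smaller_insert _ n2, smaller_insert_self]
  rw [e3]
  have p' : ((-1 : k)) ^ (smaller S (un l) + smaller S (st l)) =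
      (-1) ^ ((insert l (insert l' V))ᶜ.card + (l : ℕ) + if l' < l then 1 else 0) := by
    rw [← p]
    split_ifs
    · rw [pow_add _ _ 1, pow_add _ _ 1]; ring
    · rfl
  rw [pow_add _ _ (if pick X l' < pick X l then 1 else 0),
    pow_add _ _ (if pick X l' < pick X l then 1 else 0), ← p', pow_add, pow_add]
  by_cases hl : l ∈ X
  · rw [if_pos hl, pick_of_mem hl, star_st, if_neg not_st_lt_un]
    ring
  · rw [if_neg hl, pick_of_notMem hl, star_un, if_pos un_lt_st]
    ring

/-- On the transversal, row l is supported at `pick X l`. Hence only the skew pairs of l and l'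
contribute to the pairing of rows l and l', each with ±x at the transversal times one of two linked
coordinates, and the linear relation cancels them. -/
theorem isIsotropic_cocircuitMatrix {x : Coord n → k} (hx : x ∈ CoordSpace k n)
    (X : Finset (Fin n)) : IsIsotropic (rowSpace (cocircuitMatrix x X)) := by
  apply isIsotropic_rowSpace
  intro l l'
  by_cases h : l = l'
  · rw [h, symp_self]
  have hstar {a b : Fin n} (hab : a ≠ b) :
      cocircuit x ((minorSet X X).erase (pick X b)) (star (pick X a)) =
        (-1) ^ smaller ((minorSet X X).erase (pick X b)) (star (pick X a)) *
          coord x (minorSet (insert b ((X.erase a).erase b)) (insert a ((X.erase a).erase b))) := by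
    rw [cocircuit_of_notMem x fun hm => star_pick_notMem X a (mem_of_mem_erase hm),
      insert_star_erase_pick X hab]
  change symp (cocircuit x ((minorSet X X).erase (pick X l)))
    (cocircuit x ((minorSet X X).erase (pick X l'))) = 0
  rw [symp_eq_sum_pick X, ← sum_subset (subset_univ {l, l'})]
  · rw [sum_pair h, cocircuit_erase_self, cocircuit_erase_self, cocircuit_erase_of_ne x X h,
      cocircuit_erase_of_ne x X (Ne.symm h), hstar h, hstar (Ne.symm h)]
    have s1 := sign_cocircuit_pairing (k := k) X h
    have s2 := sign_cocircuit_pairing (k := k) X (Ne.symm h)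
    rw [erase_right_comm, insert_comm l' l] at s2
    rw [erase_right_comm (a := l') (b := l)]
    set V := (X.erase l).erase l' with hV
    have hlin := mem_CoordSpace_iff.1 hx V l' l (Ne.symm h) (by simp [hV]) (by simp [hV])
    set a := coord x (minorSet (insert l' V) (insert l V))
    set b := coord x (minorSet (insert l V) (insert l' V))
    -- Each comparison is reversed when l and l' are exchanged, so the two exponents add up to 2.
    have hpar : (-1 : k) ^ ((if l' < l then 1 else 0) + (if pick X l' < pick X l then 1 else 0)) =
        (-1 : k) ^ ((if l < l' then 1 else 0) + (if pick X l < pick X l' then 1 else 0)) := by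
      have hp : pick X l ≠ pick X l' := fun e => h (pick_injective X e)
      rcases lt_or_gt_of_ne h with h1 | h1 <;> rcases lt_or_gt_of_ne hp with h2 | h2 <;>
        simp [h1, h2, h1.not_gt, h2.not_gt]
    rw [add_assoc, pow_add, pow_add] at s1 s2
    rw [hpar] at s1
    linear_combination coord x (minorSet X X) * a * s1 - coord x (minorSet X X) * b * s2 -
      coord x (minorSet X X) * (-1) ^ (insert l (insert l' V))ᶜ.card *
      (-1) ^ ((if l < l' then 1 else 0) + (if pick X l < pick X l' then 1 else 0)) * hlin
  · intro i _ hi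
    simp only [mem_insert, mem_singleton, not_or] at hi
    rw [cocircuit_erase_of_ne x X (Ne.symm hi.1), cocircuit_erase_of_ne x X (Ne.symm hi.2)]
    ring

/-- Up to the order of columns, the submatrix on the transversal is diagonal with entries ±x at that
transversal. -/
theorem maxMinor_cocircuitMatrix_ne_zero {x : Coord n → k} {X : Finset (Fin n)}
    (h0 : coord x (minorSet X X) ≠ 0) :
    maxMinor (cocircuitMatrix x X) (minorSet X X) ≠ 0 := by
  have hc : (minorSet X X).card = n := by
    have := card_minorSet X X
    omega
  rw [maxMinor_of_card _ _ hc]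
  intro h
  obtain ⟨c, hc0, hcL⟩ := Matrix.exists_vecMul_eq_zero_iff.2 h
  apply hc0
  funext l
  have hl : pick X l ∈ Set.range ((minorSet X X).orderEmbOfFin hc) := by
    rw [range_orderEmbOfFin]; exact pick_mem X l
  obtain ⟨t, ht⟩ := hl
  have := congrFun hcL t
  simp only [Matrix.vecMul, dotProduct, Matrix.submatrix_apply, id, Pi.zero_apply, ht,
    cocircuitMatrix, Matrix.of_apply] at this
  rw [sum_eq_single l (fun i _ hi => by rw [cocircuit_erase_of_ne x X hi, mul_zero]) (by simp),
    cocircuit_erase_self] at this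
  exact (mul_eq_zero.1 this).resolve_right (mul_ne_zero (pow_ne_zero _ (by simp)) h0)

theorem finrank_rowSpace_of_maxMinor {L : Matrix (Fin n) (E n) k} {B : Finset (E n)}
    (h : maxMinor L B ≠ 0) : Module.finrank k (rowSpace L) = n := by
  by_cases hc : B.card = n
  · rw [maxMinor_of_card _ _ hc] at h
    exact finrank_rowSpace h
  · exact absurd (dif_neg hc) h

theorem isLagrangian_cocircuitMatrix {x : Coord n → k} (hx : x ∈ CoordSpace k n)
    {X : Finset (Fin n)} (h0 : coord x (minorSet X X) ≠ 0) :
    IsLagrangian (rowSpace (cocircuitMatrix x X)) :=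
  isLagrangian_iff.2 ⟨isIsotropic_cocircuitMatrix hx X,
    finrank_rowSpace_of_maxMinor (maxMinor_cocircuitMatrix_ne_zero h0)⟩

/-- The Plücker vector of a matrix recovers its row space. -/
theorem rowSpace_cocircuitMatrix_plucker {L : Matrix (Fin n) (E n) k}
    (hL : IsLagrangian (rowSpace L)) {X : Finset (Fin n)}
    (h0 : coord (plucker L) (minorSet X X) ≠ 0) :
    rowSpace (cocircuitMatrix (plucker L) X) = rowSpace L := by
  apply Submodule.eq_of_le_of_finrank_eq
  · refine Submodule.span_le.2 ?_
    rintro _ ⟨l, rfl⟩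
    obtain ⟨U, i, hi, hU⟩ := erase_pick X l
    change cocircuit (plucker L) ((minorSet X X).erase (pick X l)) ∈ rowSpace L
    rw [hU]
    exact cocircuit_plucker_mem L hi
  · rw [(isLagrangian_iff.1 hL).2,
      finrank_rowSpace_of_maxMinor (maxMinor_cocircuitMatrix_ne_zero h0)]

theorem rowSpace_cocircuitMatrix_smul {c : k} (hc : c ≠ 0) (x : Coord n → k)
    (X : Finset (Fin n)) :
    rowSpace (cocircuitMatrix (c • x) X) = rowSpace (cocircuitMatrix x X) := by
  have hle (c : k) (x : Coord n → k) :
      rowSpace (cocircuitMatrix (c • x) X) ≤ rowSpace (cocircuitMatrix x X) := by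
    refine Submodule.span_le.2 ?_
    rintro _ ⟨l, rfl⟩
    change cocircuit (c • x) ((minorSet X X).erase (pick X l)) ∈ _
    rw [cocircuit_smul]
    exact Submodule.smul_mem _ _ (row_mem_rowSpace (cocircuitMatrix x X) l)
  refine le_antisymm (hle c x) ?_
  have := hle c⁻¹ (c • x)
  rwa [smul_smul, inv_mul_cancel₀ hc, one_smul] at this

/-- Solutions of the linear and the restricted Grassmann–Plücker relations are Plücker vectors. -/
theorem exists_smul_plucker_eq {x : Coord n → k} {X : Finset (Fin n)}
    (hr : ∀ S T, IsRGPIndex S T → rgp x S T = 0) (h0 : coord x (minorSet X X) ≠ 0) :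
    ∃ c : k, c ≠ 0 ∧ c • plucker (cocircuitMatrix x X) = x := by
  set L := cocircuitMatrix x X with hL
  have hX : coord (plucker L) (minorSet X X) ≠ 0 := by
    rw [coord_plucker _ (Or.inl (isTransversal_minorSet.2 rfl))]
    exact maxMinor_cocircuitMatrix_ne_zero h0
  set c := coord x (minorSet X X) / coord (plucker L) (minorSet X X) with hc
  have hc0 : c ≠ 0 := div_ne_zero h0 hX
  have hcX : c * coord (plucker L) (minorSet X X) = coord x (minorSet X X) :=
    div_mul_cancel₀ _ hX
  refine ⟨c, hc0, ?_⟩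
  refine (eq_of_coord_eq_near hr (fun S T h => ?_) h0 (by rw [coord_smul, hcX]) ?_).symm
  · rw [rgp_smul, rgp_plucker L h, mul_zero]
  · intro f hf e he
    obtain ⟨l, rfl⟩ := exists_eq_pick hf
    set T := (minorSet X X).erase (pick X l) with hT
    have heT : e ∉ T := fun h => he (mem_of_mem_erase h)
    obtain ⟨U, i, hi, hU⟩ := erase_pick X l
    -- The cocircuit of the Plücker vector at T is a combination d of the rows of L. Comparing
    -- entries at the columns of the transversal shows that only row l occurs, with coefficient 1/c;
    -- the remaining columns then give the near coordinates.
    obtain ⟨d, hd⟩ := cocircuit_plucker L hi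
    rw [← hU, ← hT] at hd
    have hLa (a e) : L a e = cocircuit x ((minorSet X X).erase (pick X a)) e := rfl
    have hda (a : Fin n) : cocircuit (plucker L) T (pick X a) =
        d a * ((-1) ^ smaller (minorSet X X) (pick X a) * coord x (minorSet X X)) := by
      rw [hd, sum_eq_single a, hLa, cocircuit_erase_self]
      · intro b _ hb
        rw [hLa, cocircuit_erase_of_ne x X hb, mul_zero]
      · simp
    have hd0 (a) (ha : a ≠ l) : d a = 0 := by
      have := hda a
      rw [hT, cocircuit_erase_of_ne _ X (Ne.symm ha)] at this
      exact (mul_eq_zero.1 this.symm).resolve_right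
        (mul_ne_zero (pow_ne_zero _ (by simp)) h0)
    have hdl : c * d l = 1 := by
      have := hda l
      rw [hT, cocircuit_erase_self] at this
      have h2 : (-1) ^ smaller (minorSet X X) (pick X l) * coord x (minorSet X X) *
          (c * d l - 1) = 0 := by
        linear_combination (-c) * this + (-1) ^ smaller (minorSet X X) (pick X l) * hcX
      exact sub_eq_zero.1 ((mul_eq_zero.1 h2).resolve_left
        (mul_ne_zero (pow_ne_zero _ (by simp)) h0))
    have he1 := hd e
    rw [sum_eq_single l (fun b _ hb => by rw [hd0 b hb, zero_mul]) (by simp), hLa, ← hT,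
      cocircuit_of_notMem _ heT, cocircuit_of_notMem _ heT] at he1
    have h3 : (-1) ^ smaller T e * (coord x (insert e T) - c * coord (plucker L) (insert e T)) =
        0 := by
      linear_combination (-c) * he1 - (-1) ^ smaller T e * coord x (insert e T) * hdl
    rw [coord_smul]
    exact sub_eq_zero.1 ((mul_eq_zero.1 h3).resolve_left (pow_ne_zero _ (by simp)))

theorem plucker_ne_zero {L : Matrix (Fin n) (E n) k} (hL : IsLagrangian (rowSpace L)) :
    plucker L ≠ 0 := by
  obtain ⟨X, hX⟩ := exists_maxMinor_ne_zero hL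
  intro h
  rw [← coord_plucker _ (Or.inl (isTransversal_minorSet.2 rfl)), h, coord_zero] at hX
  exact hX rfl

/-- Matrices with the same row space have proportional Plücker vectors. -/
theorem exists_plucker_eq_smul {L L' : Matrix (Fin n) (E n) k} (h : rowSpace L' = rowSpace L) :
    ∃ c : k, plucker L' = c • plucker L := by
  have hG (a : Fin n) : ∃ c : Fin n → k, ∀ e, L' a e = ∑ b, c b * L b e :=
    mem_rowSpace_iff.1 (h ▸ row_mem_rowSpace L' a)
  choose G hG using hG
  refine ⟨(Matrix.of G).det, ?_⟩
  funext B
  rw [Pi.smul_apply, smul_eq_mul, plucker, plucker, ← Matrix.det_mul]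
  congr 1
  ext a t
  rw [Matrix.submatrix_apply, id, hG, Matrix.mul_apply]
  rfl

/-- The Plücker vector of a Lagrangian subspace given as a row space. -/
def pluckerVec (L : Matrix (Fin n) (E n) k) (hL : IsLagrangian (rowSpace L)) : CoordSpace k n :=
  ⟨plucker L, plucker_mem_CoordSpace hL.1⟩

theorem pluckerVec_ne_zero (L : Matrix (Fin n) (E n) k) (hL : IsLagrangian (rowSpace L)) :
    pluckerVec L hL ≠ 0 := fun h => plucker_ne_zero hL (congrArg Subtype.val h)

/-- The forward direction recovers both row spaces from proportional vectors, using cocircuits at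
one transversal where neither vanishes. -/
theorem mk_pluckerVec_eq_iff {L L' : Matrix (Fin n) (E n) k} (hL : IsLagrangian (rowSpace L))
    (hL' : IsLagrangian (rowSpace L')) :
    Projectivization.mk k (pluckerVec L hL) (pluckerVec_ne_zero L hL) =
      Projectivization.mk k (pluckerVec L' hL') (pluckerVec_ne_zero L' hL') ↔
    rowSpace L = rowSpace L' := by
  rw [Projectivization.mk_eq_mk_iff']
  constructor
  · rintro ⟨c, hc⟩
    have hc' : c • plucker L' = plucker L := congrArg Subtype.val hc
    have hc0 : c ≠ 0 := by
      rintro rfl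
      rw [zero_smul] at hc'
      exact plucker_ne_zero hL hc'.symm
    obtain ⟨X, hX⟩ := exists_maxMinor_ne_zero hL'
    rw [← coord_plucker _ (Or.inl (isTransversal_minorSet.2 rfl))] at hX
    rw [← rowSpace_cocircuitMatrix_plucker hL' hX, ← rowSpace_cocircuitMatrix_smul hc0, hc',
      rowSpace_cocircuitMatrix_plucker hL]
    rw [← hc', coord_smul]
    exact mul_ne_zero hc0 hX
  · intro h
    obtain ⟨c, hc⟩ := exists_plucker_eq_smul h
    exact ⟨c, Subtype.ext hc.symm⟩

/-- The parameterization of the Lagrangian Grassmannian. -/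
theorem exists_parameterization :
    ∃ Φ : Lag k n → Projectivization k (CoordSpace k n),
      (∀ W : Lag k n,
        (∃ L : Matrix (Fin n) (E n) k, rowSpace L = W.1) ∧
        ∀ L : Matrix (Fin n) (E n) k, rowSpace L = W.1 →
          ∃ (x : CoordSpace k n) (hx : x ≠ 0),
            x.1 = plucker L ∧ Φ W = Projectivization.mk k x hx) ∧
      Function.Injective Φ ∧
      Set.range Φ = {p | SatisfiesRGP p} := by
  choose M hM using fun W : Lag k n => exists_rowSpace_eq W.2
  have hML (W : Lag k n) : IsLagrangian (rowSpace (M W)) := by rw [hM]; exact W.2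
  have hrep (L : Matrix (Fin n) (E n) k) (hL : IsLagrangian (rowSpace L)) :
      Projectivization.mk k (pluckerVec (M ⟨_, hL⟩) (hML _)) (pluckerVec_ne_zero _ _) =
        Projectivization.mk k (pluckerVec L hL) (pluckerVec_ne_zero L hL) :=
    (mk_pluckerVec_eq_iff _ _).2 (hM ⟨_, hL⟩)
  refine ⟨fun W => Projectivization.mk k (pluckerVec (M W) (hML W)) (pluckerVec_ne_zero _ _),
    fun W => ⟨⟨M W, hM W⟩, ?_⟩, ?_, ?_⟩
  · rintro L hL
    have hLag : IsLagrangian (rowSpace L) := by rw [hL]; exact W.2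
    refine ⟨pluckerVec L hLag, pluckerVec_ne_zero _ _, rfl, ?_⟩
    exact (mk_pluckerVec_eq_iff _ _).2 ((hM W).trans hL.symm)
  · intro W W' h
    have := (mk_pluckerVec_eq_iff _ _).1 h
    rw [hM, hM] at this
    exact Subtype.ext this
  · ext p
    constructor
    · rintro ⟨W, rfl⟩ S T hST
      obtain ⟨a, ha⟩ := Projectivization.exists_smul_eq_mk_rep k _
        (pluckerVec_ne_zero (M W) (hML W))
      rw [← ha]
      change rgp ((a : k) • plucker (M W)) S T = 0
      rw [rgp_smul, rgp_plucker _ hST, mul_zero]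
    · intro hp
      have hx0 : p.rep.1 ≠ 0 := fun h => p.rep_nonzero (Subtype.ext h)
      obtain ⟨X, hX⟩ := exists_coord_transversal_ne_zero p.rep.2 hx0 hp
      have hL := isLagrangian_cocircuitMatrix p.rep.2 hX
      obtain ⟨c, hc0, hc⟩ := exists_smul_plucker_eq hp hX
      refine ⟨⟨_, hL⟩, ?_⟩
      refine (hrep _ hL).trans (Eq.trans ?_ p.mk_rep)
      rw [Projectivization.mk_eq_mk_iff']
      refine ⟨c⁻¹, Subtype.ext ?_⟩
      change c⁻¹ • p.rep.1 = plucker _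
      conv_lhs => rw [← hc]
      rw [smul_smul, inv_mul_cancel₀ hc0, one_smul]

end Parameterization

/-! ### Laplace expansions and minors of [I | A] -/

section Laplace

variable {k : Type*} [Field k] {n : ℕ}

/-- The exponent of the sign in `minorCoord`. -/
def signExp (X : Finset (Fin n)) : ℕ := ∑ i ∈ Xᶜ, ((i : ℕ) + 1 + smallerEq Xᶜ i)

theorem minorCoord_eq (x : Coord n → k) (X Y : Finset (Fin n)) :
    minorCoord x X Y = (-1) ^ signExp X * coord x (minorSet X Y) := rfl

/-- The new element raises the counts of the larger elements, and its own count covers the smaller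
ones and itself; together these add |Z| + 1. -/
theorem sum_smallerEq_insert {Z : Finset (Fin n)} {z : Fin n} (hz : z ∉ Z) :
    ∑ i ∈ insert z Z, ((i : ℕ) + 1 + smallerEq (insert z Z) i) =
      ∑ i ∈ Z, ((i : ℕ) + 1 + smallerEq Z i) + (z + 1 + Z.card + 1) := by
  have h1 (i) : smallerEq (insert z Z) i = smallerEq Z i + if z ≤ i then 1 else 0 := by
    unfold smallerEq
    rw [filter_insert]
    split_ifs
    · rw [card_insert_of_notMem (by simp [hz])]
    · simp
  have h2 : smallerEq Z z + ∑ i ∈ Z, (if z ≤ i then 1 else 0) = Z.card := by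
    rw [← card_filter, smallerEq, ← card_union_of_disjoint]
    · rw [← filter_or, filter_true_of_mem fun i _ => le_total i z]
    · rw [disjoint_filter]
      intro i hi h h'
      exact hz (le_antisymm h h' ▸ hi)
  rw [sum_insert hz, sum_congr rfl fun i _ => by rw [h1, ← add_assoc], sum_add_distrib, h1,
    if_pos le_rfl]
  omega

theorem signExp_eq_insert {V : Finset (Fin n)} {i : Fin n} (hi : i ∉ V) :
    signExp V = signExp (insert i V) + (i + 1 + (insert i V)ᶜ.card + 1) := by
  have h : Vᶜ = insert i (insert i V)ᶜ := by
    ext a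
    simp only [mem_compl, mem_insert]
    by_cases ha : a = i
    · simp [ha, hi]
    · simp [ha]
  rw [signExp, h, sum_smallerEq_insert (by simp), signExp]

theorem card_compl_eq_insert {V : Finset (Fin n)} {i : Fin n} (hi : i ∉ V) :
    Vᶜ.card = (insert i V)ᶜ.card + 1 := by
  rw [card_compl, card_compl, card_insert_of_notMem hi, Fintype.card_fin]
  have := card_lt_univ_of_notMem hi
  rw [Fintype.card_fin] at this
  omega

/-- The restricted Grassmann–Plücker relations as Laplace expansions. -/
theorem rgp_eq_laplaceDiff {U V : Finset (Fin n)} {i j : Fin n} (hUV : U ⊆ V) (hi : i ∉ V) :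
    ∃ s : ℕ, ∀ x : Coord n → k,
      rgp x (minorSet V (insert j V)) (minorSet (insert i U) U) =
        (-1) ^ s * laplaceDiff (minorCoord x) U V i j := by
  have hiU : i ∉ U := fun h => hi (hUV h)
  set S := minorSet V (insert j V) with hS
  set T := minorSet (insert i U) U with hT
  have hST : S \ T = insert (un i) ((insert j V \ U).image st) := by
    apply ext_E
    · intro a
      simp only [hS, hT, mem_sdiff, un_mem_minorSet, mem_insert, un_inj, mem_image, st_ne_un]
      constructor
      · rintro ⟨h1, h2⟩
        by_contra h3
        exact h2 fun h => h3 (Or.inl (h.resolve_right fun h => h1 (hUV h)))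
      · rintro (rfl | ⟨_, _, h⟩)
        · exact ⟨hi, fun h => h (Or.inl rfl)⟩
        · exact h.elim
    · intro a
      simp [hS, hT]
  -- The exponent is chosen so that the term at e = i becomes d[U,U] d[V+i,V+j].
  refine ⟨smaller S (un i) + smaller T (un i) + signExp (insert i V) + signExp U, fun x => ?_⟩
  rw [rgp, hST, sum_insert (by simp), sum_image fun a _ b _ h => st_inj.1 h, laplaceDiff, mul_sub,
    sub_eq_add_neg]
  congr 1
  · rw [hS, hT, erase_un_minorSet, insert_un_minorSet, erase_insert hiU, minorCoord_eq,
      minorCoord_eq, pow_add, pow_add]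
    linear_combination
      (-(-1) ^ (smaller S (un i) + smaller T (un i)) * coord x (minorSet U U) *
        coord x (minorSet (insert i V) (insert j V))) *
      (neg_one_pow_mul_self (k := k) (signExp (insert i V)) *
          (-1) ^ signExp U * (-1) ^ signExp U +
        neg_one_pow_mul_self (k := k) (signExp U))
  · rw [mul_sum, ← sum_neg_distrib]
    refine sum_congr rfl fun j' hj' => ?_
    rw [hS, hT, erase_st_minorSet, insert_st_minorSet, ← hS, ← hT, minorCoord_eq, minorCoord_eq]
    set a := coord x (minorSet V ((insert j V).erase j'))
    set b := coord x (minorSet (insert i U) (insert j' U))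
    -- Oddness is the minus sign before the sum over j'. Once all exponents are written as counts in
    -- U, V and V+j, it is linear arithmetic modulo 2.
    have hodd : Odd ((smaller S (st j') + smaller T (st j')) +
        ((smaller S (un i) + smaller T (un i) + signExp (insert i V) + signExp U) +
        (smaller (V \ U) i + smaller (insert j V \ U) j') + signExp (insert i U) +
          signExp V)) := by
      rw [Nat.odd_iff]
      have f1 := smaller_compl V i
      have f2 := smaller_compl (insert i U) i
      have f3 := smaller_insert_self U i
      have f4 := smaller_sdiff V U hUV i
      have f5 := smaller_sdiff (insert j V) U (hUV.trans (subset_insert j V)) j'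
      have f6 := signExp_eq_insert hi
      have f7 := signExp_eq_insert hiU
      have f8 := card_compl_eq_insert hi
      have g1 := smaller_minorSet_un V (insert j V) i
      have g2 := smaller_minorSet_un (insert i U) U i
      have g3 := smaller_minorSet_st V (insert j V) j'
      have g4 := smaller_minorSet_st (insert i U) U j'
      rw [← hS] at g1 g3
      rw [← hT] at g2 g4
      omega
    have h1 := hodd.neg_one_pow (α := k)
    rw [pow_add] at h1
    set p := smaller S (st j') + smaller T (st j')
    have hp := neg_one_pow_mul_self (k := k) p
    have h2 : (-1 : k) ^ ((smaller S (un i) + smaller T (un i) + signExp (insert i V) + signExp U) +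
        (smaller (V \ U) i + smaller (insert j V \ U) j') + signExp (insert i U) +
          signExp V) = -(-1) ^ p := by
      linear_combination (-1) ^ p * h1 - (-1 : k) ^ ((smaller S (un i) + smaller T (un i) +
        signExp (insert i V) + signExp U) + (smaller (V \ U) i + smaller (insert j V \ U) j') +
        signExp (insert i U) + signExp V) * hp
    rw [pow_add _ _ (signExp V), pow_add _ _ (signExp (insert i U)),
      pow_add _ _ (smaller (V \ U) i + smaller (insert j V \ U) j')] at h2
    linear_combination (a * b) * h2

theorem graphMatrix_un (A : Matrix (Fin n) (Fin n) k) (a b : Fin n) :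
    graphMatrix A a (un b) = (1 : Matrix (Fin n) (Fin n) k) a b := rfl

theorem graphMatrix_st (A : Matrix (Fin n) (Fin n) k) (a b : Fin n) :
    graphMatrix A a (st b) = A a b := rfl

theorem isLagrangian_graphMatrix {A : Matrix (Fin n) (Fin n) k} (hA : A.IsSymm) :
    IsLagrangian (rowSpace (graphMatrix A)) := by
  refine isLagrangian_iff.2 ⟨isIsotropic_rowSpace fun a b => ?_, finrank_rowSpace (c := un) ?_⟩
  · simp only [symp, graphMatrix_un, graphMatrix_st, sum_sub_distrib, Matrix.one_apply, ite_mul,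
      mul_ite, one_mul, mul_one, zero_mul, mul_zero, sum_ite_eq, mem_univ, if_true]
    rw [hA.apply, sub_self]
  · have : (graphMatrix A).submatrix id un = 1 := by
      ext a b
      exact graphMatrix_un A a b
    rw [this, Matrix.det_one]
    exact one_ne_zero

theorem minorCoord_empty (A : Matrix (Fin n) (Fin n) k) :
    minorCoord (plucker (graphMatrix A)) ∅ ∅ = 1 := by
  have hc : (minorSet (∅ : Finset (Fin n)) ∅).card = n := by
    have := card_minorSet (∅ : Finset (Fin n)) ∅
    omega
  have hemb : (un : Fin n → E n) = (minorSet ∅ ∅).orderEmbOfFin hc :=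
    orderEmbOfFin_unique hc (by simp) fun a b h => un_lt_un.2 h
  rw [minorCoord_eq, coord_plucker _ (Or.inl (isTransversal_minorSet.2 rfl)),
    maxMinor_of_card _ _ hc, ← hemb]
  have h1 : (graphMatrix A).submatrix id un = 1 := by
    ext a b
    exact graphMatrix_un A a b
  have h2 : Even (signExp (∅ : Finset (Fin n))) := by
    rw [signExp, compl_empty]
    refine even_sum _ fun i _ => ?_
    have : smallerEq univ i = (i : ℕ) + 1 := by
      rw [smallerEq, ← Fin.card_Iic i]
      congr 1
      ext a
      simp
    rw [this]
    exact ⟨_, rfl⟩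
  rw [h1, Matrix.det_one, h2.neg_one_pow, one_mul]

/-- The cocircuit at T = [n] - i vanishes at the other unstarred columns, so it is a multiple of row
i of [I | A]. The entry at column i gives the multiple, and the entry at j* is then that multiple of
A i j. -/
theorem minorCoord_singleton (A : Matrix (Fin n) (Fin n) k) (i j : Fin n) :
    minorCoord (plucker (graphMatrix A)) (insert i ∅) (insert j ∅) = A i j := by
  set x := plucker (graphMatrix A) with hx
  set T := minorSet (insert i ∅) (∅ : Finset (Fin n)) with hT
  obtain ⟨c, hc⟩ := cocircuit_plucker (graphMatrix A) (notMem_empty i)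
  rw [← hx, ← hT] at hc
  have hca (a) : c a = cocircuit x T (un a) := by
    rw [hc, sum_eq_single a]
    · simp [graphMatrix_un]
    · intro b _ hb
      simp [graphMatrix_un, hb]
    · simp
  have h1 : cocircuit x T (st j) = c i * A i j := by
    rw [hc, sum_eq_single i, graphMatrix_st]
    · intro a _ ha
      rw [hca, cocircuit_of_mem x (by simp [hT, ha]), zero_mul]
    · simp
  rw [hca, cocircuit_of_notMem x (by simp [hT]), cocircuit_of_notMem x (by simp [hT]), hT,
    insert_st_minorSet, insert_un_minorSet, erase_insert (notMem_empty i), smaller_minorSet_un,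
    smaller_minorSet_st] at h1
  have h2 := minorCoord_empty A
  rw [← hx, minorCoord_eq] at h2
  have s1 := signExp_eq_insert (notMem_empty i)
  have s2 := smaller_compl (insert i (∅ : Finset (Fin n))) i
  have s3 : smaller (insert i (∅ : Finset (Fin n))) i = 0 := by
    rw [smaller_insert_self]; rfl
  have s4 : smaller (∅ : Finset (Fin n)) j = 0 := rfl
  have s5 : smaller (insert i (∅ : Finset (Fin n)))ᶜ i = i := by omega
  rw [s4, s5, add_zero] at h1
  rw [minorCoord_eq]
  rw [s1, pow_add, pow_add, pow_add, pow_add] at h2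
  set q := (insert i (∅ : Finset (Fin n)))ᶜ.card
  set y := coord x (minorSet (insert i ∅) (insert j ∅))
  have hq := neg_one_pow_mul_self (k := k) q
  linear_combination ((-1) ^ signExp (insert i ∅) * (-1) ^ q) * h1 + A i j * h2 -
    (-1) ^ signExp (insert i ∅) * y * hq

theorem exists_insert_eq {X Y : Finset (Fin n)} (h : X.card = Y.card) (h1 : (X \ Y).card ≤ 1)
    (h0 : X.Nonempty) : ∃ V i j, i ∉ V ∧ j ∉ V ∧ X = insert i V ∧ Y = insert j V := by
  by_cases hXY : X = Y
  · obtain ⟨i, hi⟩ := h0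
    exact ⟨X.erase i, i, i, by simp, by simp, (insert_erase hi).symm,
      by rw [← hXY, insert_erase hi]⟩
  · have hA : IsAlmostTransversal (minorSet X Y) := by
      refine ⟨by have := card_minorSet X Y; omega, ?_⟩
      rw [card_inter_star]
      have h2 := card_sdiff_comm h
      have h3 : (X \ Y).card ≠ 0 := fun h3 => hXY
        (eq_of_subset_of_card_le (sdiff_eq_empty_iff_subset.1 (card_eq_zero.1 h3)) h.ge)
      omega
    obtain ⟨V, i, j, -, h⟩ := isAlmostTransversal_minorSet.1 hA
    exact ⟨V, i, j, h⟩

/-- The coordinates of `[I | A]` are the principal and almost-principal minors of `A`. -/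
theorem det_submatrix_eq_minorCoord (A : Matrix (Fin n) (Fin n) k) (m : ℕ) :
    ∀ (X Y : Finset (Fin n)) (hX : X.card = m) (hY : Y.card = m), (X \ Y).card ≤ 1 →
      (A.submatrix (X.orderEmbOfFin hX) (Y.orderEmbOfFin hY)).det =
        minorCoord (plucker (graphMatrix A)) X Y := by
  induction m with
  | zero =>
    intro X Y hX hY _
    rw [Matrix.det_isEmpty]
    obtain rfl := card_eq_zero.1 hX
    obtain rfl := card_eq_zero.1 hY
    exact (minorCoord_empty A).symm
  | succ m ih =>
    intro X Y hX hY hXY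
    obtain ⟨V, i, j, hi, hj, rfl, rfl⟩ := exists_insert_eq (hX.trans hY.symm) hXY
      (card_pos.1 (by omega))
    have hV : V.card = m := by
      rw [card_insert_of_notMem hi] at hX
      omega
    -- With U = ∅ the relation has the shape of the expansion of det A[V+i, V+j] along row i. The
    -- induction hypothesis covers the cofactors, as V \ (V+j-j') is contained in {j'}.
    obtain ⟨s, hs⟩ := rgp_eq_laplaceDiff (k := k) (empty_subset V) hi
    have h := hs (plucker (graphMatrix A))
    rw [rgp_plucker _ (isRGPIndex_iff.2 ⟨V, j, ∅, i, hj, notMem_empty i, rfl, rfl⟩)] at h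
    have h' := (mul_eq_zero.1 h.symm).resolve_left (pow_ne_zero _ (by simp))
    rw [laplaceDiff, minorCoord_empty, one_mul, sub_eq_zero, sdiff_empty, sdiff_empty] at h'
    rw [h', det_submatrix_insert A V (insert j V) hi hV hX hY]
    refine sum_congr rfl fun j' hj' => ?_
    have hc : ((insert j V).erase j').card = m := by
      rw [card_erase_of_mem hj', hY]; rfl
    rw [minorCoord_singleton, maxMinor_of_card _ _ hc, Matrix.submatrix_submatrix,
      Function.comp_id, Function.id_comp, ih V _ hV hc]
    calc (V \ (insert j V).erase j').card ≤ ({j'} : Finset (Fin n)).card := by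
          apply card_le_card
          intro a ha
          simp only [mem_sdiff, mem_erase, mem_insert, not_and, not_or] at ha
          by_contra hne
          exact (ha.2 (by simpa using hne)).2 ha.1
      _ = 1 := card_singleton _

end Laplace

end LagGr

theorem theorem1 (k : Type*) [Field k] (n : ℕ) :
    -- the projective space of `CoordSpace k n` has dimension `2^(n-2) (4 + C(n,2)) - 1`
    (Module.finrank k (LagGr.CoordSpace k n) : ℚ) =
        (2 : ℚ) ^ ((n : ℤ) - 2) * (4 + (n.choose 2 : ℚ)) ∧
    -- the parameterization by the maximal minors of a matrix with the given row space
    (∃ Φ : LagGr.Lag k n → Projectivization k (LagGr.CoordSpace k n),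
      (∀ W : LagGr.Lag k n,
        (∃ L : Matrix (Fin n) (LagGr.E n) k, LagGr.rowSpace L = W.1) ∧
        ∀ L : Matrix (Fin n) (LagGr.E n) k, LagGr.rowSpace L = W.1 →
          ∃ (x : LagGr.CoordSpace k n) (hx : x ≠ 0),
            x.1 = LagGr.plucker L ∧ Φ W = Projectivization.mk k x hx) ∧
      Function.Injective Φ ∧
      Set.range Φ = {p | LagGr.SatisfiesRGP p}) ∧
    -- on `[I | A]` with `A` symmetric, the coordinates are the principal and almost-principal
    -- minors of `A` up to sign
    (∀ A : Matrix (Fin n) (Fin n) k, A.IsSymm →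
      LagGr.IsLagrangian (LagGr.rowSpace (LagGr.graphMatrix A)) ∧
      ∀ (X Y : Finset (Fin n)) (h : Y.card = X.card), (X \ Y).card ≤ 1 →
        LagGr.minor A X Y h = LagGr.minorCoord (LagGr.plucker (LagGr.graphMatrix A)) X Y) ∧
    -- in these terms, restricted Grassmann–Plücker relations are Laplace expansions
    (∀ (U V : Finset (Fin n)) (i j : Fin n), U ⊆ V → i ∉ V → j ∉ V →
      LagGr.IsRGPIndex (LagGr.minorSet V (insert j V)) (LagGr.minorSet (insert i U) U) ∧
      ∃ s : ℕ, ∀ x : LagGr.Coord n → k,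
        LagGr.rgp x (LagGr.minorSet V (insert j V)) (LagGr.minorSet (insert i U) U) =
          (-1) ^ s * LagGr.laplaceDiff (LagGr.minorCoord x) U V i j) := by
  refine ⟨LagGr.finrank_CoordSpace, LagGr.exists_parameterization, fun A hA =>
    ⟨LagGr.isLagrangian_graphMatrix hA, fun X Y h hXY =>
      LagGr.det_submatrix_eq_minorCoord A _ X Y rfl h hXY⟩,
    fun U V i j hUV hi hj => ⟨?_, LagGr.rgp_eq_laplaceDiff hUV hi⟩⟩
  exact LagGr.isRGPIndex_iff.2 ⟨V, j, U, i, hj, fun h => hi (hUV h), rfl, rfl⟩
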